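/- Work over an algebraically closed field $K$ of characteristic zero. Let $r,d\ge 0$ be integers such that $k:=d-(2r-2)\ge 4$, let $\mathbb P^N$ be the projective space of degree $d$ hypersurfaces in $\mathbb P^r$, and let $\mathbb G(1,r)$ be the Grassmannian of lines in $\mathbb P^r$. For a multiplicity vector $(m_1,\dots,m_k)$, i.e. a vector of positive integers with $\sum_i m_i=d$, let $$I_k^\circ(m_1,\dots,m_k)=\Big\{(X,\ell)\in\mathbb P^N\times\mathbb G(1,r)\ \Big|\ X\cap\ell=\sum_{i=1}^k m_ip_i \text{ as divisors on } \ell,\text{ for distinct points } p_i\in\ell\Big\}$$ (that is, $\ell$ is a $k$-incident line of $X$ with multiplicity vector $(m_1,\dots,m_k)$), and let $I_k(m_1,\dots,m_k)$ be its Zariski closure in $\mathbb P^N\times\mathbb G(1,r)$. Let $M_{0,k}/S_k$ be the moduli space of $k$ distinct unordered points on $\mathbb P^1$, up to automorphisms of $\mathbb P^1$, and let $$i_{(m_1,\dots,m_k)}: I_k(m_1,\dots,m_k)\dashrightarrow M_{0,k}/S_k$$ be the map, defined on $I_k^\circ(m_1,\dots,m_k)$, that sends $(X,\ell)$ to the class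 $[\ell\cap X\subset\ell]$ of the set-theoretic intersection $\ell\cap X$ in $\ell\cong\mathbb P^1$. Then for a general hypersurface $X$ of degree $d$, i.e. for every $X$ in some nonempty Zariski open subset of $\mathbb P^N$, and for every multiplicity vector $(m_1,\dots,m_k)$, the map $i_{(m_1,\dots,m_k)}$ is defined at all points of $I_k(m_1,\dots,m_k)$ over $X$ (every $(X,\ell)\in I_k(m_1,\dots,m_k)$ lies in $I_k^\circ(m_1,\dots,m_k)$), and any two distinct $(X,\ell),(X,\ell')\in I_k(m_1,\dots,m_k)$ have distinct images under it: $$i_{(m_1,\dots,m_k)}(X,\ell)\neq i_{(m_1,\dots,m_k)}(X,\ell').$$ -/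

import Mathlib

open scoped LinearAlgebra.Projectivization

namespace LineModuli

variable (K : Type*) [Field K]

/-- Degree `d` forms in the homogeneous coordinates `x_0, …, x_r`. -/
abbrev Form (r d : ℕ) : Type _ := MvPolynomial.homogeneousSubmodule (Fin (r + 1)) K d

/-- The projective space `ℙ^N` of degree `d` hypersurfaces in `ℙ^r`: nonzero degree `d` forms up to
nonzero scalars. -/
abbrev Hypersurface (r d : ℕ) : Type _ := ℙ K (Form K r d)

/-- Lines in `ℙ^r`, i.e. points of the Grassmannian `𝔾(1, r)`: two-dimensional linear subspaces of
`K^(r+1)`. The points of the line `ℓ` are the elements of `ℙ K ℓ.1`. -/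
abbrev Line (r : ℕ) : Type _ :=
  {W : Submodule K (Fin (r + 1) → K) // Module.finrank K W = 2}

variable {K}

/-- The homogeneous coordinates of a hypersurface in `ℙ^N`, namely the coefficients of a form `F`
(those at exponents of degree other than `d` are zero). -/
def coeffs {r d : ℕ} (F : Form K r d) : (Fin (r + 1) →₀ ℕ) → K := fun e => F.1.coeff e

/-- Zariski open subsets of `ℙ^N`: complements of common zero loci of sets of homogeneous
polynomials in the coefficients of the form. -/
def IsZariskiOpen {r d : ℕ} (U : Set (Hypersurface K r d)) : Prop :=
  ∃ S : Set (MvPolynomial (Fin (r + 1) →₀ ℕ) K),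
    (∀ Φ ∈ S, ∃ n : ℕ, Φ.IsHomogeneous n) ∧
      Uᶜ = {X | ∀ Φ ∈ S, MvPolynomial.eval (coeffs X.rep) Φ = 0}

/-- The set-theoretic intersection `ℓ ∩ X`, as a set of points of `ℓ`. -/
def interSet {r d : ℕ} (X : Hypersurface K r d) (ℓ : Line K r) : Set (ℙ K ℓ.1) :=
  {p | ∀ w ∈ p.submodule, MvPolynomial.eval (w : Fin (r + 1) → K) X.rep.1 = 0}

/-- `ℓ` is `k`-incident to `X`: the set `ℓ ∩ X` consists of exactly `k` points
(`k` is meant to be positive). -/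
def IsIncident {r d : ℕ} (k : ℕ) (X : Hypersurface K r d) (ℓ : Line K r) : Prop :=
  (interSet X ℓ).ncard = k

/-- `X ∩ ℓ = ∑ i, m i • p i` as divisors on `ℓ`: the restriction to `ℓ` of an equation of `X` is a
nonzero constant times `∏ i, (L i) ^ (m i)`, where `L i` is a linear form on `ℓ` whose only zero is
the point `p i`. -/
def InterDivisorEq {r d k : ℕ} (X : Hypersurface K r d) (ℓ : Line K r) (m : Fin k → ℕ)
    (p : Fin k → ℙ K ℓ.1) : Prop :=
  ∃ (c : K) (L : Fin k → Module.Dual K ℓ.1), c ≠ 0 ∧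
    (∀ i, LinearMap.ker (L i) = (p i).submodule) ∧
    ∀ w : ℓ.1, MvPolynomial.eval (w : Fin (r + 1) → K) X.rep.1 = c * ∏ i, L i w ^ m i

/-- A multiplicity vector `(m_1, …, m_k)`: positive integers with sum `d`. -/
structure MultVector (k d : ℕ) where
  /-- The entries of the vector. -/
  val : Fin k → ℕ
  pos : ∀ i, 1 ≤ val i
  sum_eq : ∑ i, val i = d

/-- The pairs `(X, ℓ)` with `X ∩ ℓ = ∑ i, m i • p i` for distinct points `p i` of `ℓ`, i.e. `ℓ` is
a `k`-incident line of `X` with multiplicity vector `m`. -/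
def openIncidence {k d : ℕ} (r : ℕ) (m : MultVector k d) :
    Set (Hypersurface K r d × Line K r) :=
  {z | ∃ p : Fin k → ℙ K z.2.1, Function.Injective p ∧ InterDivisorEq z.1 z.2 m.val p}

/-- The affine coordinates of a representative `(F, u, v)` of a point of `ℙ^N × 𝔾(1, r)`: the
coefficients of the form `F`, and the entries of a frame `u, v` of the line. -/
def frameCoords {r d : ℕ} (F : Form K r d) (u v : Fin (r + 1) → K) :
    (Fin (r + 1) →₀ ℕ) ⊕ (Fin (r + 1) ⊕ Fin (r + 1)) → K :=
  Sum.elim (coeffs F) (Sum.elim u v)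

/-- `(F, u, v)` represents the pair `(X, ℓ)`: `F = 0` is an equation of `X`, and `u, v` is a basis
of `ℓ`. -/
def Represents {r d : ℕ} (F : Form K r d) (u v : Fin (r + 1) → K)
    (z : Hypersurface K r d × Line K r) : Prop :=
  (∃ hF : F ≠ 0, Projectivization.mk K F hF = z.1) ∧ Submodule.span K {u, v} = z.2.1

/-- The Zariski closure in `ℙ^N × 𝔾(1, r)`. This variety is the quotient of the space of triples
`(F, u, v)`, with `F ≠ 0` and `u, v` linearly independent, by the free action of
`GL_1 × GL_2`; it carries the quotient topology, so a point is in the closure of `A` when each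
polynomial in the affine coordinates of triples that vanishes on the triples representing points
of `A` also vanishes on the triples representing that point. -/
def zariskiClosure {r d : ℕ} (A : Set (Hypersurface K r d × Line K r)) :
    Set (Hypersurface K r d × Line K r) :=
  {z | ∀ Φ : MvPolynomial ((Fin (r + 1) →₀ ℕ) ⊕ (Fin (r + 1) ⊕ Fin (r + 1))) K,
    (∀ y ∈ A, ∀ F u v, Represents F u v y → MvPolynomial.eval (frameCoords F u v) Φ = 0) →
      ∀ F u v, Represents F u v z → MvPolynomial.eval (frameCoords F u v) Φ = 0}

/-- The incidence variety `I_k(m_1, …, m_k) ⊆ ℙ^N × 𝔾(1, r)`. -/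
def incidence {k d : ℕ} (r : ℕ) (m : MultVector k d) : Set (Hypersurface K r d × Line K r) :=
  zariskiClosure (openIncidence r m)

variable (K) in
/-- Sets of `k` distinct unordered points on `ℙ^1`. -/
abbrev PointSet (k : ℕ) : Type _ := {S : Set (ℙ K (Fin 2 → K)) // S.ncard = k}

variable (K) in
/-- Two sets of `k` points of `ℙ^1` are equivalent when an automorphism of `ℙ^1` carries one to
the other. -/
def pointSetSetoid (k : ℕ) : Setoid (PointSet K k) where
  r S T := ∃ g : (Fin 2 → K) ≃ₗ[K] (Fin 2 → K),
    Projectivization.map g.toLinearMap g.injective '' S.1 = T.1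
  iseqv :=
    { refl := fun S => ⟨LinearEquiv.refl K _, by
        simp⟩
      symm := by
        rintro S T ⟨g, hg⟩
        refine ⟨g.symm, ?_⟩
        rw [← hg, ← Set.image_comp, ← Projectivization.map_comp]
        simp
      trans := by
        rintro S T V ⟨g, hg⟩ ⟨h, hh⟩
        refine ⟨g.trans h, ?_⟩
        rw [← hh, ← hg, ← Set.image_comp, ← Projectivization.map_comp]
        rfl }

variable (K) in
/-- The moduli space `M_{0,k} / S_k` (its points): `k` unordered distinct points on `ℙ^1` up to
automorphisms of `ℙ^1`. -/
def UnorderedM0 (k : ℕ) : Type _ := Quotient (pointSetSetoid K k)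

/-- A choice of coordinates on a line. -/
noncomputable def lineCoords {r : ℕ} (ℓ : Line K r) : ℓ.1 ≃ₗ[K] (Fin 2 → K) :=
  haveI : Module.Finite K ℓ.1 := Module.finite_of_finrank_eq_succ ℓ.2
  LinearEquiv.ofFinrankEq _ _ (by rw [ℓ.2]; simp)

theorem ncard_image_of_isIncident {r d k : ℕ} {X : Hypersurface K r d} {ℓ : Line K r}
    (h : IsIncident k X ℓ) (e : ℓ.1 ≃ₗ[K] (Fin 2 → K)) :
    (Projectivization.map e.toLinearMap e.injective '' interSet X ℓ).ncard = k := by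
  rw [Set.ncard_image_of_injective _ (Projectivization.map_injective _ _)]
  exact h

/-- The point `[ℓ ∩ X ⊂ ℓ]` of `M_{0,k} / S_k` given by a `k`-incident line `ℓ` of `X`. -/
noncomputable def moduliPoint {r d k : ℕ} (X : Hypersurface K r d) (ℓ : Line K r)
    (h : IsIncident k X ℓ) : UnorderedM0 K k :=
  Quotient.mk (pointSetSetoid K k) ⟨_, ncard_image_of_isIncident h (lineCoords ℓ)⟩

/-- `moduliPoint` does not depend on the choice of coordinates: two `k`-incident lines give the same
point exactly when an isomorphism of the lines matches the two sets of points. -/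
theorem moduliPoint_eq_iff {r d k : ℕ} {X X' : Hypersurface K r d} {ℓ ℓ' : Line K r}
    (h : IsIncident k X ℓ) (h' : IsIncident k X' ℓ') :
    moduliPoint X ℓ h = moduliPoint X' ℓ' h' ↔
      ∃ e : ℓ.1 ≃ₗ[K] ℓ'.1,
        Projectivization.map e.toLinearMap e.injective '' interSet X ℓ = interSet X' ℓ' := by
  have key : moduliPoint X ℓ h = moduliPoint X' ℓ' h' ↔ ∃ g : (Fin 2 → K) ≃ₗ[K] (Fin 2 → K),
      Projectivization.map g.toLinearMap g.injective ''
        (Projectivization.map (lineCoords ℓ).toLinearMap (lineCoords ℓ).injective ''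
          interSet X ℓ) =
        Projectivization.map (lineCoords ℓ').toLinearMap (lineCoords ℓ').injective ''
          interSet X' ℓ' := Quotient.eq (r := pointSetSetoid K k)
  rw [key]
  constructor
  · rintro ⟨g, hg⟩
    refine ⟨((lineCoords ℓ).trans g).trans (lineCoords ℓ').symm, ?_⟩
    apply (Projectivization.map_injective (lineCoords ℓ').toLinearMap
      (lineCoords ℓ').injective).image_injective
    rw [← hg, ← Set.image_comp, ← Set.image_comp, ← Projectivization.map_comp,
      ← Projectivization.map_comp]
    congr 2
    ext
    simp
  · rintro ⟨e, he⟩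
    refine ⟨((lineCoords ℓ).symm.trans e).trans (lineCoords ℓ'), ?_⟩
    rw [← he, ← Set.image_comp, ← Set.image_comp, ← Projectivization.map_comp,
      ← Projectivization.map_comp]
    congr 2
    ext
    simp

theorem interSet_eq_range {r d k : ℕ} {X : Hypersurface K r d} {ℓ : Line K r} {m : Fin k → ℕ}
    (hm : ∀ i, 1 ≤ m i) {p : Fin k → ℙ K ℓ.1} (h : InterDivisorEq X ℓ m p) :
    interSet X ℓ = Set.range p := by
  obtain ⟨c, L, hc, hL, hF⟩ := h
  ext q
  constructor
  · intro hq
    have h0 := hq q.rep (by rw [Projectivization.submodule_eq]; exact Submodule.mem_span_singleton_self _)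
    rw [hF] at h0
    obtain ⟨i, -, hi⟩ := Finset.prod_eq_zero_iff.1 ((mul_eq_zero.1 h0).resolve_left hc)
    have hi' : q.rep ∈ (p i).submodule := by
      rw [← hL i]
      exact pow_eq_zero_iff (by have := hm i; omega) |>.1 hi
    refine ⟨i, ?_⟩
    rw [Projectivization.submodule_eq, Submodule.mem_span_singleton] at hi'
    obtain ⟨a, ha⟩ := hi'
    rw [← Projectivization.mk_rep q, ← Projectivization.mk_rep (p i)]
    exact ((Projectivization.mk_eq_mk_iff' K _ _ q.rep_nonzero (p i).rep_nonzero).2 ⟨a, ha⟩).symm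
  · rintro ⟨i, rfl⟩ w hw
    rw [← hL i, LinearMap.mem_ker] at hw
    rw [hF, Finset.prod_eq_zero (Finset.mem_univ i)]
    · simp
    · rw [hw]
      exact zero_pow (by have := hm i; omega)

theorem isIncident_of_mem {k d r : ℕ} {m : MultVector k d} {z : Hypersurface K r d × Line K r}
    (hz : z ∈ openIncidence r m) : IsIncident k z.1 z.2 := by
  obtain ⟨p, hp, h⟩ := hz
  unfold IsIncident
  rw [interSet_eq_range m.pos h, Set.ncard_range_of_injective hp]
  simp

/-- The rational map `I_k(m_1, …, m_k) ⇢ M_{0,k} / S_k`, `(X, ℓ) ↦ [ℓ ∩ X ⊂ ℓ]`, on the dense open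
subset of `I_k(m_1, …, m_k)` where this formula makes sense. -/
noncomputable def crossRatioMap {k d : ℕ} (r : ℕ) (m : MultVector k d)
    (z : (openIncidence r m : Set (Hypersurface K r d × Line K r))) : UnorderedM0 K k :=
  moduliPoint z.1.1 z.1.2 (isIncident_of_mem z.2)

end LineModuli

/-!
Write `k = j + 4`, so that `d = 2 r + j + 2`. The theorem is a count of parameters, carried out as a
count of transcendence degrees at a generic point.

A set `B` of coefficient vectors is *thin* if a nonzero polynomial vanishes on it. If `B` is not
thin, then some `K`-algebra homomorphism `φ` from the functions on `B` to a field `L` makes the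
coordinates algebraically independent (`exists_generic`: take a prime ideal that avoids the nonzero
polynomial functions). Any data that the points of `B` carry by polynomial identities (a line, the
zeros of the form on it) are functions on `B`, so `φ` carries them to data of the same kind over
`L`. If the data are generated by `σ` parameters and prescribe the values of `ρ` independent linear
functionals with coefficients rational in the parameters, then `ρ ≤ σ`, and `ρ < σ` if the
parameters are algebraically dependent (`card_le_of_linearIndependent`). Charts on Grassmannians and
elimination theory are not needed.

The functionals are the coefficients of the restriction to a line. On one line they are `d + 1`
independent functionals, on two skew lines `2 (d + 1)`, on two lines that meet `2 d + 1`. The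
parameters are the vectors of a frame of each line, and the zeros that remain once three of them are
moved to `∞`, `0`, `-1`; the scalar factor of the form is absorbed in the frame
(`exists_normal_frame`). The inequalities then read as follows.

* A form that vanishes on a line, or has fewer than `k` zeros there: at most `2 (r + 1) + j`
  parameters, fewer than `d + 1` (`thin_fewZeros`).
* Two skew lines with projectively equivalent sets of `k` zeros: `4 (r + 1) + (j + 1)` parameters,
  fewer than `2 (d + 1)`.
* Two such lines that meet: `3 (r + 1) + (j + 1) + 3` parameters, the last three being the
  coordinates of the common point in the two frames. The value of the form at this point gives one
  algebraic relation between them, and `3 (r + 1) + (j + 1) + 3 ≤ 2 d + 1` (`thin_equivalentZeros`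
  covers both cases).

Outside a hypersurface in `ℙ^N`, therefore, none of this happens. That the closure `I_k(m)` adds nothing
over such a form is a separate matter: the monic polynomials `∏ (T - a_i) ^ m_i` form a Zariski
closed set, because the `a_i` are integral over the coefficients
(`exists_eq_prod_of_forall_eval_eq_zero`). So a form over which a line lies in the closure still
splits with multiplicities `m_i` on that line, and its zeros cannot collide if there are at least
`k` of them.
-/

namespace LineModuli

/-! ### Transcendence degree and generic points of families -/

section Transcendence

universe u v


variable {K L n σ τ : Type*} [Field K] [Field L] [Algebra K L]

/-- The generic point of a family of points that no nonzero polynomial kills. Functions on the family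
specialize to elements of the field `L`, and polynomial identities between them are preserved. -/
theorem exists_generic {K : Type u} {n : Type*} {B : Type v} [Field K] (f : B → n → K)
    (hB : ∀ P : MvPolynomial n K, (∀ y, MvPolynomial.eval (f y) P = 0) → P = 0) :
    ∃ (L : Type (max u v)) (_ : Field L) (_ : Algebra K L) (φ : (B → K) →ₐ[K] L),
      AlgebraicIndependent K (fun i => φ (fun y => f y i)) := by
  classical
  let ev : MvPolynomial n K →ₐ[K] (B → K) := MvPolynomial.aeval (fun i x => f x i)
  have ev_apply : ∀ P x, ev P x = MvPolynomial.eval (f x) P := by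
    intro P x
    have : (Pi.evalAlgHom K (fun _ : B => K) x).comp ev = MvPolynomial.aeval (f x) := by
      ext i; simp [ev]
    have h := DFunLike.congr_fun this P
    simpa [MvPolynomial.aeval_eq_eval] using h
  have ev_inj : ∀ P, ev P = 0 → P = 0 := fun P hP => hB P fun x => by
    rw [← ev_apply P x, hP]; rfl
  let S : Submonoid (B → K) := (nonZeroDivisors (MvPolynomial n K)).map (ev : _ →* (B → K))
  have hdis : Disjoint ((⊥ : Ideal (B → K)) : Set (B → K)) S := by
    rw [Set.disjoint_left]
    rintro x hx ⟨P, hP, hPx⟩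
    have hx0 : x = 0 := by simpa using hx
    have : P = 0 := ev_inj P (by rw [← hx0, ← hPx]; rfl)
    exact nonZeroDivisors.ne_zero hP this
  obtain ⟨p, hp, -, hpS⟩ := Ideal.exists_le_prime_disjoint _ S hdis
  let Q := (B → K) ⧸ p
  let φ : (B → K) →ₐ[K] FractionRing Q :=
    (IsScalarTower.toAlgHom K Q (FractionRing Q)).comp (Ideal.Quotient.mkₐ K p)
  refine ⟨FractionRing Q, inferInstance, inferInstance, φ, ?_⟩
  have hφ : ∀ f, φ f = 0 → f ∈ p := by
    intro f hf
    have h1 : algebraMap Q (FractionRing Q) (Ideal.Quotient.mk p f) = 0 := hf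
    rw [← map_zero (algebraMap Q (FractionRing Q))] at h1
    exact Ideal.Quotient.eq_zero_iff_mem.1 (IsFractionRing.injective Q (FractionRing Q) h1)
  rw [algebraicIndependent_iff]
  intro P hP
  by_contra hne
  have h1 : φ (ev P) = 0 := by
    rw [← hP, ← AlgHom.comp_apply]
    congr 1
    ext i
    simp [ev]
  exact Set.disjoint_left.1 hpS (hφ _ h1) ⟨P, mem_nonZeroDivisors_of_ne_zero hne, rfl⟩

theorem isAlgebraic_of_mem_adjoin {s : Set L} {a : L}
    (ha : a ∈ IntermediateField.adjoin K s) : IsAlgebraic (Algebra.adjoin K s) a := by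
  obtain ⟨r, hr, t, ht, rfl⟩ := IntermediateField.mem_adjoin_iff_div.1 ha
  have h1 := isAlgebraic_algebraMap (R := Algebra.adjoin K s) (A := L) ⟨r, hr⟩
  have h2 := isAlgebraic_algebraMap (R := Algebra.adjoin K s) (A := L) ⟨t, ht⟩
  rw [div_eq_mul_inv]
  exact h1.mul h2.inv

theorem card_le_of_mem_adjoin [Fintype n] [Fintype τ] {x : n → L} {z : τ → L}
    (hx : AlgebraicIndependent K x)
    (h : ∀ i, x i ∈ IntermediateField.adjoin K (Set.range z)) :
    Fintype.card n ≤ Fintype.card τ ∧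
      (Fintype.card n = Fintype.card τ → AlgebraicIndependent K z) := by
  let M := AlgebraicIndependent.matroid K L
  have hxi : M.Indep (Set.range x) := AlgebraicIndependent.matroid_indep_iff.2 hx.to_subtype_range
  have hcl : Set.range x ⊆ M.closure (Set.range z) := by
    rintro _ ⟨i, rfl⟩
    rw [AlgebraicIndependent.matroid_closure_eq]
    exact isAlgebraic_of_mem_adjoin (h i)
  have hle : (Set.range x).encard ≤ M.eRk (Set.range z) := by
    rw [← hxi.eRk_eq_encard, ← M.eRk_closure_eq (Set.range z)]
    exact M.eRk_mono hcl
  have hxc : (Set.range x).encard = Fintype.card n := by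
    rw [← Set.image_univ, hx.injective.encard_image, Set.encard_univ]; simp
  have hz1 := M.eRk_le_encard (Set.range z)
  have hz2 : (Set.range z).encard ≤ Fintype.card τ := by
    rw [← Set.image_univ]
    refine (Set.encard_image_le _ _).trans ?_
    rw [Set.encard_univ]; simp
  refine ⟨by exact_mod_cast hxc ▸ hle.trans (hz1.trans hz2), fun heq => ?_⟩
  have hz3 : (Set.range z).encard = Fintype.card τ :=
    le_antisymm hz2 (by rw [← heq, ← hxc]; exact hle.trans hz1)
  have hzr : M.eRk (Set.range z) = (Set.range z).encard :=
    le_antisymm hz1 (by rw [hz3, ← heq, ← hxc]; exact hle)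
  have hzi : M.Indep (Set.range z) :=
    (Matroid.indep_iff_eRk_eq_encard_of_finite (Set.finite_range z)).2 hzr
  have hinj : Function.Injective z := by
    rw [← Set.injOn_univ]
    refine Set.finite_univ.injOn_of_encard_image_eq ?_
    rw [Set.image_univ, hz3, Set.encard_univ]; simp
  exact .of_subtype_range hinj (AlgebraicIndependent.matroid_indep_iff.1 hzi)

/-- The parameter count: if the parameters `y` determine the values at an algebraically independent
vector `x` of independent linear functionals, themselves defined over `K(y)`, then there are at least
as many parameters as functionals, and more if the parameters are dependent. Indeed `K(y)` and the
coordinates of `x` in a complement of the functionals generate a field that contains `x`. -/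
theorem card_le_of_linearIndependent {J : Type*} [Fintype n] [Fintype J] [Fintype σ]
    {x : n → L} {y : σ → L} (hx : AlgebraicIndependent K x) (lam : J → n → L)
    (hlam : LinearIndependent L lam)
    (hy : ∀ j e, lam j e ∈ IntermediateField.adjoin K (Set.range y))
    (hv : ∀ j, ∑ e, lam j e * x e ∈ IntermediateField.adjoin K (Set.range y)) :
    Fintype.card J ≤ Fintype.card σ ∧
      (Fintype.card J = Fintype.card σ → AlgebraicIndependent K y) := by
  classical
  let E := IntermediateField.adjoin K (Set.range y)
  let lamE : J → n → E := fun j e => ⟨lam j e, hy j e⟩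
  have hlamE : LinearIndependent E lamE := by
    rw [Fintype.linearIndependent_iff] at hlam ⊢
    intro g hg i
    have := hlam (fun j => (g j : L)) (by
      ext e
      have := congrArg (fun f : n → E => (f e : L)) hg
      simpa [lamE] using this) i
    exact_mod_cast this
  let s : Set (n → E) := Set.range lamE
  let t : Set (n → E) := s ∪ Set.range (fun i => Pi.single i 1)
  have hs : LinearIndepOn E id s := hlamE.linearIndepOn_id
  have hst : s ⊆ t := Set.subset_union_left
  let s' := hs.extend hst
  have hs' : LinearIndepOn E id s' := hs.linearIndepOn_extend hst
  have hspan : ∀ v : n → E, v ∈ Submodule.span E s' := by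
    have h1 : Submodule.span E s' = Submodule.span E t := hs.span_extend_eq_span hst
    intro v
    rw [h1, pi_eq_sum_univ v]
    refine Submodule.sum_mem _ fun i _ => Submodule.smul_mem _ _ (Submodule.subset_span ?_)
    refine Or.inr ⟨i, ?_⟩
    ext j
    simp [Pi.single_apply, eq_comm]
  have hfin : s'.Finite := hs'.setFinite
  have hcard : s'.ncard = Fintype.card n := by
    have b := Module.Basis.mk hs' (by
      intro v _
      simpa using hspan v)
    have h2 := Module.finrank_eq_nat_card_basis b
    rw [Module.finrank_fintype_fun_eq_card] at h2
    rw [h2]; rfl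
  have hsc : s.ncard = Fintype.card J := by
    rw [show s = Set.range lamE from rfl, Set.ncard_range_of_injective hlamE.injective,
      Nat.card_eq_fintype_card]
  let I : Set n := {i | (Pi.single i 1 : n → E) ∈ s' \ s}
  have hI : I.ncard = (s' \ s).ncard := by
    have hinj : Function.Injective (fun i : n => (Pi.single i 1 : n → E)) := by
      intro i j hij
      by_contra hne
      have := congrFun hij i
      simp [hne] at this
    rw [← Set.ncard_image_of_injective I hinj]
    congr 1
    ext v
    constructor
    · rintro ⟨i, hi, rfl⟩; exact hi
    · intro hv
      obtain h | ⟨i, rfl⟩ := hs.extend_subset hst hv.1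
      · exact absurd h hv.2
      · exact ⟨i, hv, rfl⟩
  have hsum : Fintype.card J + Fintype.card I = Fintype.card n := by
    rw [← Nat.card_eq_fintype_card (α := I)]
    change _ + I.ncard = _
    rw [hI, ← hcard, ← hsc, add_comm]
    exact Set.ncard_sdiff_add_ncard_of_subset (hs.subset_extend hst) hfin
  let z : σ ⊕ I → L := Sum.elim y (fun i => x i)
  have hyz : E ≤ IntermediateField.adjoin K (Set.range z) :=
    IntermediateField.adjoin.mono K _ _ (by rw [Set.Sum.elim_range]; exact Set.subset_union_left)
  have hz : ∀ v : n → E, ∑ e, (v e : L) * x e ∈ IntermediateField.adjoin K (Set.range z) := by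
    intro v
    induction hspan v using Submodule.span_induction with
    | mem v hv' =>
      by_cases hvs : v ∈ s
      · obtain ⟨j, rfl⟩ := hvs
        exact hyz (hv j)
      · obtain h | ⟨i, rfl⟩ := hs.extend_subset hst hv'
        · exact absurd h hvs
        · have hz1 : z (Sum.inr ⟨i, hv', hvs⟩) ∈ IntermediateField.adjoin K (Set.range z) :=
            IntermediateField.subset_adjoin K _ ⟨_, rfl⟩
          convert hz1
          rw [Finset.sum_eq_single i]
          · simp [z]
          · intro j _ hj; simp [hj]
          · simp
    | zero => simp
    | add v w _ _ hv hw =>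
      simpa [add_mul, Finset.sum_add_distrib] using add_mem hv hw
    | smul a v _ hv =>
      have := mul_mem (hyz a.2) hv
      simpa [Finset.mul_sum, mul_assoc] using this
  have key := card_le_of_mem_adjoin (z := z) hx (fun i => by
    have := hz (Pi.single i 1)
    rwa [Finset.sum_eq_single i (fun j _ hj => by simp [hj]) (by simp), Pi.single_eq_same,
      OneMemClass.coe_one, one_mul] at this)
  rw [Fintype.card_sum] at key
  refine ⟨by omega, fun h => ?_⟩
  exact (key.2 (by omega)).comp Sum.inl Sum.inl_injective

end Transcendence
section Thin

universe u v

variable {K n : Type*} [Field K]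

/-- A subset of affine space is thin when it is not Zariski dense: some nonzero polynomial vanishes
on it. -/
def Thin (B : Set (n → K)) : Prop :=
  ∃ P : MvPolynomial n K, P ≠ 0 ∧ ∀ x ∈ B, MvPolynomial.eval x P = 0

/-- A family of points is thin if it has no generic point: no homomorphism from functions on the
family to an extension field makes the coordinates algebraically independent. -/
theorem thin_range_of_generic {K : Type u} {ι : Type v} {n : Type*} [Field K] {f : ι → n → K}
    (h : ∀ (L : Type (max u v)) [Field L] [Algebra K L] (φ : (ι → K) →ₐ[K] L),
      ¬ AlgebraicIndependent K (fun i => φ (fun y => f y i))) : Thin (Set.range f) := by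
  by_contra hB
  simp only [Thin, not_exists, not_and', Set.forall_mem_range] at hB
  obtain ⟨L, _, _, φ, hφ⟩ := exists_generic f (fun P hP => not_not.1 (hB P hP))
  exact h L φ hφ

theorem Thin.mono {A B : Set (n → K)} (h : Thin B) (hAB : A ⊆ B) : Thin A := by
  obtain ⟨P, hP, hB⟩ := h
  exact ⟨P, hP, fun x hx => hB x (hAB hx)⟩

theorem Thin.union {A B : Set (n → K)} (hA : Thin A) (hB : Thin B) : Thin (A ∪ B) := by
  obtain ⟨P, hP, hPA⟩ := hA
  obtain ⟨Q, hQ, hQB⟩ := hB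
  refine ⟨P * Q, mul_ne_zero hP hQ, ?_⟩
  rintro x (hx | hx)
  · simp [hPA x hx]
  · simp [hQB x hx]

theorem Thin.biUnion {ι : Type*} {s : Set ι} (hs : s.Finite) {B : ι → Set (n → K)}
    (h : ∀ i ∈ s, Thin (B i)) : Thin (⋃ i ∈ s, B i) := by
  induction s, hs using Set.Finite.induction_on with
  | empty => exact ⟨1, one_ne_zero, by simp⟩
  | @insert a s _ _ ih =>
    rw [Set.biUnion_insert]
    exact (h a (Set.mem_insert _ _)).union (ih fun i hi => h i (Set.mem_insert_of_mem _ hi))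

theorem eval_smul_of_isHomogeneous {R m : Type*} [CommRing R] {N : ℕ} {P : MvPolynomial m R}
    (hP : P.IsHomogeneous N) (a : R) (x : m → R) :
    MvPolynomial.eval (a • x) P = a ^ N * MvPolynomial.eval x P := by
  rw [MvPolynomial.eval_eq, MvPolynomial.eval_eq, Finset.mul_sum]
  refine Finset.sum_congr rfl fun e he => ?_
  have hN : e.sum (fun _ k => k) = N := by
    rw [← hP (MvPolynomial.mem_support_iff.1 he), Finsupp.weight_apply]
    simp
  simp only [Pi.smul_apply, smul_eq_mul, mul_pow, Finset.prod_mul_distrib, Finset.prod_pow_eq_pow_sum]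
  rw [show ∑ i ∈ e.support, e i = N from hN]
  ring

/-- On a cone, the homogeneous components of a vanishing polynomial vanish. -/
theorem Thin.exists_isHomogeneous [Infinite K] {B : Set (n → K)} (h : Thin B)
    (hB : ∀ x ∈ B, ∀ a : K, a ≠ 0 → a • x ∈ B) :
    ∃ (N : ℕ) (P : MvPolynomial n K), P ≠ 0 ∧ P.IsHomogeneous N ∧
      ∀ x ∈ B, MvPolynomial.eval x P = 0 := by
  obtain ⟨P, hP, hPB⟩ := h
  obtain ⟨N, hN⟩ : ∃ N, MvPolynomial.homogeneousComponent N P ≠ 0 := by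
    by_contra! hc
    exact hP (by rw [← MvPolynomial.sum_homogeneousComponent P]; simp [hc])
  refine ⟨N, _, hN, MvPolynomial.homogeneousComponent_isHomogeneous N P, fun x hx => ?_⟩
  -- `a ↦ P (a • x)` is a polynomial in `a` whose coefficients are the homogeneous components at `x`.
  let q : Polynomial K := ∑ i ∈ Finset.range (P.totalDegree + 1),
    Polynomial.monomial i (MvPolynomial.eval x (MvPolynomial.homogeneousComponent i P))
  have hq : ∀ a, q.eval a = MvPolynomial.eval (a • x) P := by
    intro a
    conv_rhs => rw [← MvPolynomial.sum_homogeneousComponent P]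
    rw [map_sum, Polynomial.eval_finsetSum]
    refine Finset.sum_congr rfl fun i _ => ?_
    rw [Polynomial.eval_monomial,
      eval_smul_of_isHomogeneous (MvPolynomial.homogeneousComponent_isHomogeneous i P)]
    ring
  have hq0 : q = 0 := by
    refine Polynomial.eq_zero_of_infinite_isRoot q
      (Set.Infinite.mono (s := {0}ᶜ) (fun a ha => ?_) (Set.finite_singleton _).infinite_compl)
    change q.eval a = 0
    rw [hq]
    exact hPB _ (hB x hx a ha)
  by_cases hNd : N ≤ P.totalDegree
  · have := congrArg (fun p => Polynomial.coeff p N) hq0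
    simpa [q, Polynomial.finsetSum_coeff, Polynomial.coeff_monomial, Nat.lt_succ_iff, hNd] using this
  · exact absurd (MvPolynomial.homogeneousComponent_eq_zero _ _ (not_le.1 hNd)) hN

end Thin

/-! ### Restriction of a form to a line -/

section Restriction

open Polynomial (C X)

/-- The exponents of the monomials of degree `d` in `x_0, …, x_r`. -/
abbrev Exps (r d : ℕ) : Type :=
  {e : Fin (r + 1) →₀ ℕ // e ∈ Finset.finsuppAntidiag Finset.univ d}

variable {R S : Type*} [CommRing R] [CommRing S] {r d : ℕ}

/-- The value at `w` of the form of degree `d` with coefficient vector `x`. -/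
def evalForm (x : Exps r d → R) (w : Fin (r + 1) → R) : R :=
  ∑ e, x e * ∏ i, w i ^ (e.1 i)

/-- The form with coefficient vector `x` restricted to the affine line `T ↦ T u + v`, as a polynomial
in `T`. By homogeneity it determines the restriction to the span of `u` and `v`. -/
noncomputable def restr (x : Exps r d → R) (u v : Fin (r + 1) → R) : Polynomial R :=
  evalForm (fun e => C (x e)) (fun i => C (u i) * X + C (v i))

/-- The `j`-th coefficient of `restr x u v`, as a linear functional of `x`. -/
noncomputable def restrCoeff (u v : Fin (r + 1) → R) (j : ℕ) (e : Exps r d) : R :=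
  (∏ i, (C (u i) * X + C (v i)) ^ (e.1 i)).coeff j

theorem sum_exps (e : Exps r d) : ∑ i, e.1 i = d := (Finset.mem_finsuppAntidiag.1 e.2).1

theorem map_evalForm (φ : R →+* S) (x : Exps r d → R) (w : Fin (r + 1) → R) :
    φ (evalForm x w) = evalForm (fun e => φ (x e)) (fun i => φ (w i)) := by
  simp [evalForm]

theorem map_restr (φ : R →+* S) (x : Exps r d → R) (u v : Fin (r + 1) → R) :
    (restr x u v).map φ = restr (fun e => φ (x e)) (fun i => φ (u i)) (fun i => φ (v i)) := by
  have := map_evalForm (Polynomial.mapRingHom φ) (fun e => C (x e))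
    (fun i => C (u i) * X + C (v i))
  simpa [restr] using this

theorem eval_restr (x : Exps r d → R) (u v : Fin (r + 1) → R) (t : R) :
    (restr x u v).eval t = evalForm x (t • u + v) := by
  have := map_evalForm (Polynomial.evalRingHom t) (fun e => C (x e))
    (fun i => C (u i) * X + C (v i))
  simp only [Polynomial.coe_evalRingHom] at this
  rw [restr, this]
  simp only [Polynomial.eval_C, Polynomial.eval_add, Polynomial.eval_mul, Polynomial.eval_X]
  congr 1
  ext i
  simp [mul_comm (u i) t]

theorem coeff_restr (x : Exps r d → R) (u v : Fin (r + 1) → R) (j : ℕ) :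
    (restr x u v).coeff j = ∑ e, restrCoeff u v j e * x e := by
  rw [restr, evalForm, Polynomial.finsetSum_coeff]
  refine Finset.sum_congr rfl fun e _ => ?_
  rw [Polynomial.coeff_C_mul, mul_comm]
  rfl

theorem natDegree_restr_le (x : Exps r d → R) (u v : Fin (r + 1) → R) :
    (restr x u v).natDegree ≤ d := by
  rw [restr, evalForm]
  refine Polynomial.natDegree_sum_le_of_forall_le _ _ fun e _ => ?_
  refine (Polynomial.natDegree_C_mul_le _ _).trans ((Polynomial.natDegree_prod_le _ _).trans ?_)
  conv_rhs => rw [← sum_exps e]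
  refine Finset.sum_le_sum fun i _ => (Polynomial.natDegree_pow_le).trans ?_
  have : (C (u i) * X + C (v i)).natDegree ≤ 1 := Polynomial.natDegree_linear_le
  simpa using Nat.mul_le_mul_left (e.1 i) this

theorem coeff_prod_sum_of_natDegree_le {ι : Type*} (s : Finset ι) (f : ι → Polynomial R) (n : ι → ℕ)
    (h : ∀ i ∈ s, (f i).natDegree ≤ n i) :
    (∏ i ∈ s, f i).coeff (∑ i ∈ s, n i) = ∏ i ∈ s, (f i).coeff (n i) := by
  classical
  induction s using Finset.induction_on with
  | empty => simp
  | insert a s ha ih =>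
    rw [Finset.prod_insert ha, Finset.sum_insert ha, Finset.prod_insert ha,
      Polynomial.coeff_mul_add_eq_of_natDegree_le (h a (Finset.mem_insert_self _ _))
        ((Polynomial.natDegree_prod_le _ _).trans
          (Finset.sum_le_sum fun i hi => h i (Finset.mem_insert_of_mem hi))),
      ih fun i hi => h i (Finset.mem_insert_of_mem hi)]

theorem coeff_restr_top (x : Exps r d → R) (u v : Fin (r + 1) → R) :
    (restr x u v).coeff d = evalForm x u := by
  rw [restr, evalForm, evalForm, Polynomial.finsetSum_coeff]
  refine Finset.sum_congr rfl fun e _ => ?_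
  rw [Polynomial.coeff_C_mul]
  congr 1
  have h : ∀ i ∈ Finset.univ, ((C (u i) * X + C (v i)) ^ e.1 i).natDegree ≤ e.1 i := by
    intro i _
    refine (Polynomial.natDegree_pow_le).trans ?_
    have : (C (u i) * X + C (v i)).natDegree ≤ 1 := Polynomial.natDegree_linear_le
    simpa using Nat.mul_le_mul_left (e.1 i) this
  have := coeff_prod_sum_of_natDegree_le _ _ _ h
  rw [sum_exps] at this
  rw [this]
  refine Finset.prod_congr rfl fun i _ => ?_
  have h1 : (C (u i) * X + C (v i)).natDegree ≤ 1 := Polynomial.natDegree_linear_le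
  have := Polynomial.coeff_pow_of_natDegree_le (n := 1) (m := e.1 i) h1
  rw [mul_one] at this
  rw [this]; simp

theorem map_restrCoeff (φ : R →+* S) (u v : Fin (r + 1) → R) (j : ℕ) (e : Exps r d) :
    φ (restrCoeff u v j e) = restrCoeff (fun i => φ (u i)) (fun i => φ (v i)) j e := by
  rw [restrCoeff, restrCoeff, ← Polynomial.coeff_map, Polynomial.map_prod]
  simp

theorem evalForm_smul (x : Exps r d → R) (a : R) (w : Fin (r + 1) → R) :
    evalForm x (a • w) = a ^ d * evalForm x w := by
  rw [evalForm, evalForm, Finset.mul_sum]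
  refine Finset.sum_congr rfl fun e _ => ?_
  simp only [Pi.smul_apply, smul_eq_mul, mul_pow, Finset.prod_mul_distrib, Finset.prod_pow_eq_pow_sum,
    sum_exps]
  ring

theorem smul_evalForm (x : Exps r d → R) (a : R) (w : Fin (r + 1) → R) :
    evalForm (a • x) w = a * evalForm x w := by
  simp [evalForm, Finset.mul_sum, mul_assoc]

theorem evalForm_coeff (φ : R →+* S) {G : MvPolynomial (Fin (r + 1)) R} (hG : G.IsHomogeneous d)
    (w : Fin (r + 1) → S) :
    evalForm (fun e : Exps r d => φ (G.coeff e.1)) w = G.eval₂ φ w := by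
  rw [MvPolynomial.eval₂_eq', evalForm,
    Finset.sum_coe_sort (Finset.finsuppAntidiag Finset.univ d)
      (fun e => φ (G.coeff e) * ∏ i, w i ^ e i)]
  symm
  refine Finset.sum_subset (fun e he => ?_) (fun e _ he => ?_)
  · rw [Finset.mem_finsuppAntidiag]
    refine ⟨?_, Finset.subset_univ _⟩
    have := hG (MvPolynomial.mem_support_iff.1 he)
    rw [Finsupp.weight_apply, Finsupp.sum_fintype _ _ (by simp)] at this
    simpa using this
  · rw [MvPolynomial.notMem_support_iff.1 he]; simp

theorem restr_coeff {G : MvPolynomial (Fin (r + 1)) R} (hG : G.IsHomogeneous d)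
    (u v : Fin (r + 1) → R) :
    restr (fun e : Exps r d => G.coeff e.1) u v =
      G.eval₂ C (fun i => C (u i) * X + C (v i)) :=
  evalForm_coeff C hG _

/-- The linear form with coefficient vector `ξ`. -/
noncomputable def linForm (ξ : Fin (r + 1) → R) : MvPolynomial (Fin (r + 1)) R :=
  ∑ i, MvPolynomial.C (ξ i) * MvPolynomial.X i

theorem linForm_isHomogeneous (ξ : Fin (r + 1) → R) : (linForm ξ).IsHomogeneous 1 :=
  MvPolynomial.IsHomogeneous.sum _ _ _ fun i _ => by
    simpa using (MvPolynomial.isHomogeneous_C _ (ξ i)).mul (MvPolynomial.isHomogeneous_X R i)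

theorem eval₂_linForm (ξ u v : Fin (r + 1) → R) :
    (linForm ξ).eval₂ C (fun i => C (u i) * X + C (v i)) = C (ξ ⬝ᵥ u) * X + C (ξ ⬝ᵥ v) := by
  simp only [linForm, MvPolynomial.eval₂_sum, MvPolynomial.eval₂_mul, MvPolynomial.eval₂_C,
    MvPolynomial.eval₂_X, dotProduct, map_sum, map_mul, Finset.sum_mul, mul_add,
    Finset.sum_add_distrib, mul_assoc]

/-- The binary form `t^{μ_0} s^{μ_1} (s + t)^{μ_2} ∏ (s + b_i t)^{μ_{i+3}}`: the normal form of a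
binary form with at least three distinct zeros, three of which are moved to `0`, `∞` and `-1`. -/
def normalForm {j : ℕ} (μ : Fin (j + 3) → ℕ) (b : Fin j → R) (s t : R) : R :=
  t ^ μ 0 * (s ^ μ 1 * ((s + t) ^ μ 2 * ∏ i : Fin j, (s + b i * t) ^ μ i.succ.succ.succ))

theorem map_normalForm {j : ℕ} (φ : R →+* S) (μ : Fin (j + 3) → ℕ) (b : Fin j → R) (s t : R) :
    φ (normalForm μ b s t) = normalForm μ (fun i => φ (b i)) (φ s) (φ t) := by
  simp [normalForm]

/-- The normal form at `t = 1`, as a polynomial in `s`. -/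
noncomputable def normalPoly {j : ℕ} (μ : Fin (j + 3) → ℕ) (b : Fin j → R) : Polynomial R :=
  normalForm μ (fun i => C (b i)) X 1

theorem map_normalPoly {j : ℕ} (φ : R →+* S) (μ : Fin (j + 3) → ℕ) (b : Fin j → R) :
    (normalPoly μ b).map φ = normalPoly μ (fun i => φ (b i)) := by
  have := map_normalForm (Polynomial.mapRingHom φ) μ (fun i => C (b i)) X 1
  simpa [normalPoly] using this

theorem eval_normalPoly {j : ℕ} (μ : Fin (j + 3) → ℕ) (b : Fin j → R) (s : R) :
    (normalPoly μ b).eval s = normalForm μ b s 1 := by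
  have := map_normalForm (Polynomial.evalRingHom s) μ (fun i => C (b i)) X 1
  simpa [normalPoly] using this

end Restriction

section Independence

open Polynomial (C X)

variable {L : Type*} [Field L] {r d : ℕ}

theorem restrCoeff_mem {K : Type*} [Field K] [Algebra K L] {E : IntermediateField K L}
    {u v : Fin (r + 1) → L} (hu : ∀ i, u i ∈ E) (hv : ∀ i, v i ∈ E) (j : ℕ) (e : Exps r d) :
    restrCoeff u v j e ∈ E := by
  have := map_restrCoeff (algebraMap E L) (fun i => ⟨u i, hu i⟩) (fun i => ⟨v i, hv i⟩) j e
  rw [show restrCoeff u v j e = _ from this.symm]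
  exact SetLike.coe_mem _

theorem coeff_normalPoly_mem {K : Type*} [Field K] [Algebra K L] {E : IntermediateField K L} {m : ℕ}
    (μ : Fin (m + 3) → ℕ) {b : Fin m → L} (hb : ∀ i, b i ∈ E) (j : ℕ) :
    (normalPoly μ b).coeff j ∈ E := by
  have := map_normalPoly (algebraMap E L) μ (fun i => ⟨b i, hb i⟩)
  rw [show normalPoly μ b = _ from this.symm, Polynomial.coeff_map]
  exact SetLike.coe_mem _

/-- A linear relation between the coefficients on two lines, tested on a product of powers of linear
forms. -/
theorem sum_restrCoeff_test {J J' : Type*} [Fintype J] [Fintype J'] (g : J → L) (g' : J' → L)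
    (a : J → ℕ) (a' : J' → ℕ) {u v u' v' : Fin (r + 1) → L}
    (h : ∀ e : Exps r d, ∑ j, g j * restrCoeff u v (a j) e +
      ∑ j, g' j * restrCoeff u' v' (a' j) e = 0)
    {G : MvPolynomial (Fin (r + 1)) L} (hG : G.IsHomogeneous d) :
    ∑ j, g j * (G.eval₂ C (fun i => C (u i) * X + C (v i))).coeff (a j) +
      ∑ j, g' j * (G.eval₂ C (fun i => C (u' i) * X + C (v' i))).coeff (a' j) = 0 := by
  rw [← restr_coeff hG, ← restr_coeff hG]
  simp only [coeff_restr, Finset.mul_sum]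
  rw [Finset.sum_comm, Finset.sum_comm (s := Finset.univ (α := J')), ← Finset.sum_add_distrib]
  refine Finset.sum_eq_zero fun e _ => ?_
  have := congrArg (· * G.coeff e.1) (h e)
  simpa [add_mul, Finset.sum_mul, mul_assoc] using this

theorem powMul_isHomogeneous (ξ η : Fin (r + 1) → L) {i : ℕ} (hi : i ≤ d) :
    (linForm ξ ^ i * linForm η ^ (d - i)).IsHomogeneous d := by
  have := ((linForm_isHomogeneous ξ).pow i).mul ((linForm_isHomogeneous η).pow (d - i))
  convert this using 1
  omega

/-- The coefficients of a form on a line are independent functionals. -/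
theorem linearIndependent_restrCoeff {w ξ : Fin 2 → Fin (r + 1) → L}
    (hξ : ∀ a b, ξ a ⬝ᵥ w b = if a = b then 1 else 0) :
    LinearIndependent L (fun j : Fin (d + 1) => restrCoeff (d := d) (w 0) (w 1) (j : ℕ)) := by
  rw [Fintype.linearIndependent_iff]
  intro g hg i
  have h := sum_restrCoeff_test (J' := Fin 0) g (fun _ => 0) (fun j => j) (fun _ => 0)
    (u := w 0) (v := w 1) (u' := w 0) (v' := w 1) (d := d) (fun e => by
      have := congrFun hg e
      simpa using this) (powMul_isHomogeneous (ξ 0) (ξ 1) (Nat.lt_succ_iff.1 i.2))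
  simp only [MvPolynomial.eval₂_mul, MvPolynomial.eval₂_pow, eval₂_linForm, hξ] at h
  simpa [Polynomial.coeff_X_pow, Fin.val_inj] using h

/-- The coefficients of a form on two skew lines are independent functionals. -/
theorem linearIndependent_restrCoeff_skew {w ξ : Fin 4 → Fin (r + 1) → L}
    (hd : 0 < d) (hξ : ∀ a b, ξ a ⬝ᵥ w b = if a = b then 1 else 0) :
    LinearIndependent L (Sum.elim
      (fun j : Fin (d + 1) => restrCoeff (d := d) (w 0) (w 1) (j : ℕ))
      (fun j : Fin (d + 1) => restrCoeff (d := d) (w 2) (w 3) (j : ℕ))) := by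
  rw [Fintype.linearIndependent_iff]
  intro g hg
  have h := fun G => sum_restrCoeff_test (g ∘ Sum.inl) (g ∘ Sum.inr) (fun j => j) (fun j => j)
    (u := w 0) (v := w 1) (u' := w 2) (v' := w 3) (d := d) (G := G) (fun e => by
      have := congrFun hg e
      simpa using this)
  rintro (i | i)
  · have h1 := h _ (powMul_isHomogeneous (ξ 0) (ξ 1) (Nat.lt_succ_iff.1 i.2))
    simp only [MvPolynomial.eval₂_mul, MvPolynomial.eval₂_pow, eval₂_linForm, hξ] at h1
    have h0 : (0 : Polynomial L) ^ (i : ℕ) * 0 ^ (d - i) = 0 := by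
      rw [← pow_add, zero_pow (by omega)]
    simpa [h0, Polynomial.coeff_X_pow, Fin.val_inj] using h1
  · have h1 := h _ (powMul_isHomogeneous (ξ 2) (ξ 3) (Nat.lt_succ_iff.1 i.2))
    simp only [MvPolynomial.eval₂_mul, MvPolynomial.eval₂_pow, eval₂_linForm, hξ] at h1
    have h0 : (0 : Polynomial L) ^ (i : ℕ) * 0 ^ (d - i) = 0 := by
      rw [← pow_add, zero_pow (by omega)]
    simpa [h0, Polynomial.coeff_X_pow, Fin.val_inj] using h1

/-- The coefficients of a form on two lines that meet in a point are independent functionals, up to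
the one relation that equates the two values at that point. It is removed by omitting the value at
`v'`, one of the two vectors of the frame of the second line. -/
theorem linearIndependent_restrCoeff_meet {w ξ : Fin 3 → Fin (r + 1) → L}
    {v' : Fin (r + 1) → L} {η : Fin 2 → Fin (r + 1) → L}
    (hξ : ∀ a b, ξ a ⬝ᵥ w b = if a = b then 1 else 0)
    (hη : ∀ a b, η a ⬝ᵥ (![w 2, v'] : Fin 2 → Fin (r + 1) → L) b = if a = b then 1 else 0) :
    LinearIndependent L (Sum.elim
      (fun j : Fin (d + 1) => restrCoeff (d := d) (w 0) (w 1) (j : ℕ))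
      (fun j : Fin d => restrCoeff (d := d) (w 2) v' ((j : ℕ) + 1))) := by
  rw [Fintype.linearIndependent_iff]
  intro g hg
  have h := fun G => sum_restrCoeff_test (g ∘ Sum.inl) (g ∘ Sum.inr) (fun j => j) (fun j => j + 1)
    (u := w 0) (v := w 1) (u' := w 2) (v' := v') (d := d) (G := G) (fun e => by
      have := congrFun hg e
      simpa using this)
  -- Test against `ξ₂ η₀ ^ i η₁ ^ (d - 1 - i)`, which vanishes on the first line.
  have htest : ∀ i : Fin d, g (Sum.inr i) +
      (ξ 2 ⬝ᵥ v') * ∑ j : Fin d, g (Sum.inr j) * (if (j : ℕ) + 1 = i then 1 else 0) = 0 := by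
    intro i
    have hG : (linForm (ξ 2) * (linForm (η 0) ^ (i : ℕ) * linForm (η 1) ^ (d - 1 - i))).IsHomogeneous
        d := by
      have := (linForm_isHomogeneous (ξ 2)).mul
        (powMul_isHomogeneous (d := d - 1) (η 0) (η 1) (i := i) (by omega))
      convert this using 1
      have := i.pos
      omega
    have h1 := h _ hG
    have hη' : ∀ a, η a ⬝ᵥ w 2 = (if a = 0 then 1 else 0) ∧ η a ⬝ᵥ v' = if a = 1 then 1 else 0 :=
      fun a => ⟨hη a 0, hη a 1⟩
    simp only [MvPolynomial.eval₂_mul, MvPolynomial.eval₂_pow, eval₂_linForm, hξ, (hη' _).1,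
      (hη' _).2] at h1
    simp [add_mul, Polynomial.coeff_X_mul, mul_add, Finset.sum_add_distrib,
      Polynomial.coeff_X_pow, Fin.val_inj] at h1
    refine Eq.trans ?_ h1
    rw [Finset.mul_sum]
    congr 1
    refine Finset.sum_congr rfl fun j _ => ?_
    split_ifs <;> ring
  have hr : ∀ i, g (Sum.inr i) = 0 := by
    rintro ⟨i, hi⟩
    induction i with
    | zero => simpa using htest ⟨0, hi⟩
    | succ i ih =>
      have h1 := htest ⟨i + 1, hi⟩
      rw [Finset.sum_eq_single ⟨i, by omega⟩ (fun j _ hj => by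
        rw [if_neg (fun h => hj (Fin.ext (by simpa using h))), mul_zero]) (by simp),
        ih (by omega)] at h1
      simpa using h1
  rintro (i | i)
  · have h1 := h _ (powMul_isHomogeneous (ξ 0) (ξ 1) (Nat.lt_succ_iff.1 i.2))
    simp only [MvPolynomial.eval₂_mul, MvPolynomial.eval₂_pow, eval₂_linForm, hξ] at h1
    simpa [Polynomial.coeff_X_pow, Fin.val_inj, hr] using h1
  · exact hr i

end Independence

/-! ### Parameter counts for normalized families -/

section Frames

variable {r d : ℕ}

/-- The vectors `w` have dual vectors. Over a field this says that they are linearly independent, in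
the form of polynomial identities. -/
def HasDual {R : Type*} [CommRing R] {m : ℕ} (w : Fin m → Fin (r + 1) → R) : Prop :=
  ∃ ξ : Fin m → Fin (r + 1) → R, ∀ a b, ξ a ⬝ᵥ w b = if a = b then 1 else 0

variable {K : Type*} [Field K]

theorem hasDual_of_linearIndependent {m : ℕ} {w : Fin m → Fin (r + 1) → K}
    (h : LinearIndependent K w) : HasDual w := by
  obtain ⟨f, hf⟩ := (Finsupp.linearCombination K w).exists_leftInverse_of_injective
    (LinearMap.ker_eq_bot.2 h)
  refine ⟨fun a i => f (Pi.single i 1) a, fun a b => ?_⟩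
  have h1 : f (w b) = Finsupp.single b 1 := by
    have := LinearMap.congr_fun hf (Finsupp.single b 1)
    simpa using this
  have h2 : f (w b) a = ∑ i, w b i * f (Pi.single i 1) a := by
    conv_lhs => rw [pi_eq_sum_univ' (w b)]
    simp
  rw [h1, Finsupp.single_apply] at h2
  rw [dotProduct]
  simp_rw [mul_comm _ (w b _)]
  rw [← h2]
  simp [eq_comm]

theorem HasDual.linearIndependent {m : ℕ} {w : Fin m → Fin (r + 1) → K} (h : HasDual w) :
    LinearIndependent K w := by
  obtain ⟨ξ, hξ⟩ := h
  rw [Fintype.linearIndependent_iff]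
  intro g hg a
  have := congrArg (fun v => ξ a ⬝ᵥ v) hg
  simpa [dotProduct_sum, hξ] using this

theorem HasDual.card_le {m : ℕ} {w : Fin m → Fin (r + 1) → K} (h : HasDual w) : m ≤ r + 1 := by
  simpa using h.linearIndependent.fintype_card_le_finrank

end Frames

section Transfer

variable {K : Type*} [Field K] {L : Type*} [Field L] [Algebra K L] {r d : ℕ}
  {B : Type*} (φ : (B → K) →ₐ[K] L)

/-- Dual families of vectors specialize to dual families. -/
theorem dual_transfer {m : ℕ} {w ξ : B → Fin m → Fin (r + 1) → K}
    (h : ∀ x a b, ξ x a ⬝ᵥ w x b = if a = b then 1 else 0) (a b : Fin m) :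
    (fun i => φ (fun x => ξ x a i)) ⬝ᵥ (fun i => φ (fun x => w x b i)) = if a = b then 1 else 0 := by
  have h1 : (∑ i, (fun x => ξ x a i) * (fun x => w x b i) : B → K) = if a = b then 1 else 0 := by
    ext x
    have := h x a b
    rw [dotProduct] at this
    rw [Finset.sum_apply]
    simp only [Pi.mul_apply, this]
    split_ifs <;> rfl
  have h2 := congrArg φ h1
  rw [map_sum] at h2
  simp only [map_mul] at h2
  rw [dotProduct, h2]
  split_ifs <;> simp

/-- Polynomial identities for the restriction of a form specialize. -/
theorem restr_transfer {x : B → Exps r d → K} {u v : B → Fin (r + 1) → K}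
    {p : Polynomial (B → K)}
    (h : ∀ y, restr (x y) (u y) (v y) = p.map (Pi.evalRingHom _ y)) :
    restr (fun e => φ (fun y => x y e)) (fun i => φ (fun y => u y i)) (fun i => φ (fun y => v y i)) =
      p.map φ.toRingHom := by
  have h1 : restr (fun e y => x y e) (fun i y => u y i) (fun i y => v y i) = p := by
    ext j y
    have h2 := congrArg (fun q => q.coeff j) (h y)
    rw [Polynomial.coeff_map] at h2
    have h3 := map_restr (Pi.evalRingHom (fun _ : B => K) y) (fun e y => x y e) (fun i y => u y i)
      (fun i y => v y i)
    have h4 := congrArg (fun q => q.coeff j) h3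
    rw [Polynomial.coeff_map] at h4
    exact h4.trans h2
  rw [← h1, map_restr]
  rfl

theorem restr_normalPoly_transfer {x : B → Exps r d → K} {u v : B → Fin (r + 1) → K}
    {j : ℕ} {μ : Fin (j + 3) → ℕ} {b : B → Fin j → K}
    (h : ∀ y, restr (x y) (u y) (v y) = normalPoly μ (b y)) :
    restr (fun e => φ (fun y => x y e)) (fun i => φ (fun y => u y i)) (fun i => φ (fun y => v y i)) =
      normalPoly μ (fun i => φ (fun y => b y i)) := by
  rw [restr_transfer φ (p := normalPoly μ (fun i y => b y i)) (fun y => by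
    rw [h, map_normalPoly]; rfl), map_normalPoly]
  rfl

end Transfer

section Counting

variable {K : Type*} [Field K] {r d : ℕ}

theorem mem_adjoin_range {L σ : Type*} [Field L] [Algebra K L] (y : σ → L) (s : σ) :
    y s ∈ IntermediateField.adjoin K (Set.range y) :=
  IntermediateField.subset_adjoin K _ ⟨s, rfl⟩

/-- The common value of the two binary forms at the point where the lines meet is an algebraic
relation between the parameters. -/
theorem not_algebraicIndependent_of_normalForm_eq {L ι : Type*} [Field L] [Algebra K L] {j : ℕ}
    [CharZero K]
    {μ μ' : Fin (j + 3) → ℕ} (hμ' : 1 ≤ μ' 1) {y : ι ⊕ Fin j ⊕ Fin 3 → L}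
    (h : normalForm μ (fun i => y (.inr (.inl i))) (y (.inr (.inr 0))) (y (.inr (.inr 1))) =
      normalForm μ' (fun i => y (.inr (.inl i))) (y (.inr (.inr 2))) 1) :
    ¬ AlgebraicIndependent K y := by
  intro hy
  let P : MvPolynomial (ι ⊕ Fin j ⊕ Fin 3) K :=
    normalForm μ (fun i => .X (.inr (.inl i))) (.X (.inr (.inr 0))) (.X (.inr (.inr 1))) -
      normalForm μ' (fun i => .X (.inr (.inl i))) (.X (.inr (.inr 2))) 1
  have hP : MvPolynomial.aeval y P = 0 := by
    have h1 := map_normalForm (MvPolynomial.aeval y : _ →ₐ[K] L).toRingHom μ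
      (fun i => .X (.inr (.inl i))) (.X (.inr (.inr 0))) (.X (.inr (.inr 1)))
    have h2 := map_normalForm (MvPolynomial.aeval y : _ →ₐ[K] L).toRingHom μ'
      (fun i => .X (.inr (.inl i))) (.X (.inr (.inr 2))) 1
    simp only [AlgHom.toRingHom_eq_coe, RingHom.coe_coe, MvPolynomial.aeval_X, map_one] at h1 h2
    rw [map_sub, h1, h2, h, sub_self]
  have hP0 : P = 0 := (algebraicIndependent_iff.1 hy) P hP
  -- At `s = t = 1`, `s' = 0` and `b = 0` the relation reads `2 ^ μ₂ = 0`.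
  let z : ι ⊕ Fin j ⊕ Fin 3 → K := Sum.elim 0 (Sum.elim 0 ![1, 1, 0])
  have h1 := map_normalForm (MvPolynomial.eval z) μ
    (fun i => .X (.inr (.inl i))) (.X (.inr (.inr 0))) (.X (.inr (.inr 1)))
  have h2 := map_normalForm (MvPolynomial.eval z) μ'
    (fun i => .X (.inr (.inl i))) (.X (.inr (.inr 2))) 1
  have h3 : MvPolynomial.eval z P = 0 := by rw [hP0, map_zero]
  rw [map_sub, h1, h2] at h3
  simp [normalForm, z, show μ' 1 ≠ 0 by omega, show (1 : K) + 1 ≠ 0 by norm_num] at h3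

/-- Forms that vanish on a line: the parameters are the two vectors of a frame. -/
theorem thin_restr_eq_zero (hd : 2 * (r + 1) < d + 1) {ι : Type*} {x : ι → Exps r d → K}
    {w ξ : ι → Fin 2 → Fin (r + 1) → K}
    (hξ : ∀ y a b, ξ y a ⬝ᵥ w y b = if a = b then 1 else 0)
    (hx : ∀ y, restr (x y) (w y 0) (w y 1) = 0) : Thin (Set.range x) := by
  refine thin_range_of_generic fun L _ _ φ hφ => ?_
  have h1 := restr_transfer φ (x := x) (p := 0) (fun y => by rw [hx]; simp)
  have := (card_le_of_linearIndependent (σ := Fin 2 × Fin (r + 1))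
    (y := fun s => φ (fun x => w x s.1 s.2)) hφ _
    (linearIndependent_restrCoeff (d := d) (dual_transfer φ hξ))
    (fun j e => restrCoeff_mem (fun i => mem_adjoin_range _ (0, i))
      (fun i => mem_adjoin_range _ (1, i)) _ _)
    (fun j => by
      rw [← coeff_restr, h1]
      simp)).1
  simp only [Fintype.card_fin, Fintype.card_prod] at this
  omega

/-- Forms whose restriction to a line, in a suitable frame, is in normal form: the parameters are the
frame and the `j` zeros that are not normalized. -/
theorem thin_restr_eq_normalPoly {j : ℕ} (hd : 2 * (r + 1) + j < d + 1) (μ : Fin (j + 3) → ℕ)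
    {ι : Type*} {x : ι → Exps r d → K} {w ξ : ι → Fin 2 → Fin (r + 1) → K} {b : ι → Fin j → K}
    (hξ : ∀ y a b, ξ y a ⬝ᵥ w y b = if a = b then 1 else 0)
    (hx : ∀ y, restr (x y) (w y 0) (w y 1) = normalPoly μ (b y)) : Thin (Set.range x) := by
  refine thin_range_of_generic fun L _ _ φ hφ => ?_
  have h1 := restr_normalPoly_transfer φ hx
  obtain ⟨y, hyw, hyb⟩ : ∃ y : Fin 2 × Fin (r + 1) ⊕ Fin j → L,
      (∀ a i, y (.inl (a, i)) = φ (fun x => w x a i)) ∧ ∀ i, y (.inr i) = φ (fun x => b x i) :=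
    ⟨Sum.elim (fun s => φ (fun x => w x s.1 s.2)) (fun i => φ (fun x => b x i)),
      fun _ _ => rfl, fun _ => rfl⟩
  have hw : ∀ a i, φ (fun x => w x a i) ∈ IntermediateField.adjoin K (Set.range y) :=
    fun a i => hyw a i ▸ mem_adjoin_range y _
  have hb : ∀ i, φ (fun x => b x i) ∈ IntermediateField.adjoin K (Set.range y) :=
    fun i => hyb i ▸ mem_adjoin_range y _
  have := (card_le_of_linearIndependent hφ _
    (linearIndependent_restrCoeff (d := d) (dual_transfer φ hξ))
    (fun j e => restrCoeff_mem (hw 0) (hw 1) _ _)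
    (fun j => by
      rw [← coeff_restr, h1]
      exact coeff_normalPoly_mem _ hb _)).1
  simp only [Fintype.card_fin, Fintype.card_prod, Fintype.card_sum] at this
  omega

/-- Forms with the same normalized zeros on two skew lines: the parameters are the two frames and the
`j` zeros that are not normalized. -/
theorem thin_skew {j : ℕ} (hd0 : 0 < d) (hd : 4 * (r + 1) + j < 2 * (d + 1))
    (μ μ' : Fin (j + 3) → ℕ)
    {ι : Type*} {x : ι → Exps r d → K} {w ξ : ι → Fin 4 → Fin (r + 1) → K} {b : ι → Fin j → K}
    (hξ : ∀ y a b, ξ y a ⬝ᵥ w y b = if a = b then 1 else 0)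
    (hx : ∀ y, restr (x y) (w y 0) (w y 1) = normalPoly μ (b y))
    (hx' : ∀ y, restr (x y) (w y 2) (w y 3) = normalPoly μ' (b y)) : Thin (Set.range x) := by
  refine thin_range_of_generic fun L _ _ φ hφ => ?_
  have h1 := restr_normalPoly_transfer φ hx
  have h2 := restr_normalPoly_transfer φ hx'
  obtain ⟨y, hyw, hyb⟩ : ∃ y : Fin 4 × Fin (r + 1) ⊕ Fin j → L,
      (∀ a i, y (.inl (a, i)) = φ (fun x => w x a i)) ∧ ∀ i, y (.inr i) = φ (fun x => b x i) :=
    ⟨Sum.elim (fun s => φ (fun x => w x s.1 s.2)) (fun i => φ (fun x => b x i)),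
      fun _ _ => rfl, fun _ => rfl⟩
  have hw : ∀ a i, φ (fun x => w x a i) ∈ IntermediateField.adjoin K (Set.range y) :=
    fun a i => hyw a i ▸ mem_adjoin_range y _
  have hb : ∀ i, φ (fun x => b x i) ∈ IntermediateField.adjoin K (Set.range y) :=
    fun i => hyb i ▸ mem_adjoin_range y _
  have := (card_le_of_linearIndependent hφ _
    (linearIndependent_restrCoeff_skew hd0 (dual_transfer φ hξ))
    (by
      rintro (j | j) e
      · exact restrCoeff_mem (hw 0) (hw 1) _ _
      · exact restrCoeff_mem (hw 2) (hw 3) _ _)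
    (by
      rintro (j | j)
      · simp only [Sum.elim_inl]
        rw [← coeff_restr, h1]
        exact coeff_normalPoly_mem _ hb _
      · simp only [Sum.elim_inr]
        rw [← coeff_restr, h2]
        exact coeff_normalPoly_mem _ hb _)).1
  simp only [Fintype.card_fin, Fintype.card_prod, Fintype.card_sum] at this
  omega

/-- Forms with the same normalized zeros on two lines with frames `w₀, w₁` and `w₂, v'` that meet in
the point `α w₀ + β w₁ = γ w₂ + v'`. The parameters are `w₀, w₁, w₂`, the `j` zeros that are not
normalized and `α, β, γ`; they are algebraically dependent. -/
theorem thin_meet [CharZero K] {j : ℕ} (hd : 3 * (r + 1) + (j + 3) ≤ 2 * d + 1)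
    (μ μ' : Fin (j + 3) → ℕ) (hμ' : 1 ≤ μ' 1)
    {ι : Type*} {x : ι → Exps r d → K} {w ξ : ι → Fin 3 → Fin (r + 1) → K} {b : ι → Fin j → K}
    {v' : ι → Fin (r + 1) → K} {η : ι → Fin 2 → Fin (r + 1) → K} {α β γ : ι → K}
    (hξ : ∀ y a b, ξ y a ⬝ᵥ w y b = if a = b then 1 else 0)
    (hη : ∀ y a b, η y a ⬝ᵥ (![w y 2, v' y] : Fin 2 → Fin (r + 1) → K) b = if a = b then 1 else 0)
    (hw : ∀ y, v' y = α y • w y 0 + β y • w y 1 - γ y • w y 2)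
    (hr : ∀ y, normalForm μ (b y) (α y) (β y) = normalForm μ' (b y) (γ y) 1)
    (hx : ∀ y, restr (x y) (w y 0) (w y 1) = normalPoly μ (b y))
    (hx' : ∀ y, restr (x y) (w y 2) (v' y) = normalPoly μ' (b y)) : Thin (Set.range x) := by
  refine thin_range_of_generic fun L _ _ φ hφ => ?_
  have h1 := restr_normalPoly_transfer φ hx
  have h2 := restr_normalPoly_transfer φ hx'
  obtain ⟨y, hyw, hyb, hyα, hyβ, hyγ⟩ : ∃ y : Fin 3 × Fin (r + 1) ⊕ Fin j ⊕ Fin 3 → L,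
      (∀ a i, y (.inl (a, i)) = φ (fun x => w x a i)) ∧
      (∀ i, y (.inr (.inl i)) = φ (fun x => b x i)) ∧ y (.inr (.inr 0)) = φ α ∧
      y (.inr (.inr 1)) = φ β ∧ y (.inr (.inr 2)) = φ γ :=
    ⟨Sum.elim (fun s => φ (fun x => w x s.1 s.2))
      (Sum.elim (fun i => φ (fun x => b x i)) ![φ α, φ β, φ γ]),
      fun _ _ => rfl, fun _ => rfl, rfl, rfl, rfl⟩
  have hwm : ∀ a i, φ (fun x => w x a i) ∈ IntermediateField.adjoin K (Set.range y) :=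
    fun a i => hyw a i ▸ mem_adjoin_range y _
  have hbm : ∀ i, φ (fun x => b x i) ∈ IntermediateField.adjoin K (Set.range y) :=
    fun i => hyb i ▸ mem_adjoin_range y _
  have hvm : ∀ i, φ (fun x => v' x i) ∈ IntermediateField.adjoin K (Set.range y) := by
    intro i
    have : φ (fun x => v' x i) = y (.inr (.inr 0)) * y (.inl (0, i)) +
        y (.inr (.inr 1)) * y (.inl (1, i)) - y (.inr (.inr 2)) * y (.inl (2, i)) := by
      rw [hyα, hyβ, hyγ, hyw, hyw, hyw, ← map_mul, ← map_mul, ← map_mul, ← map_add, ← map_sub]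
      congr 1
      ext x
      simp [hw]
    rw [this]
    exact sub_mem (add_mem (mul_mem (mem_adjoin_range _ _) (mem_adjoin_range _ _))
      (mul_mem (mem_adjoin_range _ _) (mem_adjoin_range _ _)))
      (mul_mem (mem_adjoin_range _ _) (mem_adjoin_range _ _))
  have hdep : ¬ AlgebraicIndependent K y := by
    refine not_algebraicIndependent_of_normalForm_eq (μ := μ) hμ' ?_
    have h3 : normalForm μ (fun i x => b x i) α β = normalForm μ' (fun i x => b x i) γ 1 := by
      ext x
      have h4 := map_normalForm (Pi.evalRingHom (fun _ => K) x) μ (fun i x => b x i) α β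
      have h5 := map_normalForm (Pi.evalRingHom (fun _ => K) x) μ' (fun i x => b x i) γ 1
      exact h4.trans ((hr x).trans h5.symm)
    have h4 := map_normalForm (φ : (ι → K) →+* L) μ (fun i x => b x i) α β
    have h5 := map_normalForm (φ : (ι → K) →+* L) μ' (fun i x => b x i) γ 1
    rw [map_one] at h5
    simp only [hyα, hyβ, hyγ, hyb]
    exact h4.symm.trans ((congrArg φ h3).trans h5)
  have hdual := dual_transfer φ hη
  have := card_le_of_linearIndependent (y := y) hφ _
    (linearIndependent_restrCoeff_meet (d := d) (dual_transfer φ hξ)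
      (v' := fun i => φ (fun x => v' x i)) (η := fun a i => φ (fun x => η x a i)) (by
        intro a c
        rw [← hdual a c]
        fin_cases c <;> rfl))
    (by
      rintro (j | j) e
      · exact restrCoeff_mem (hwm 0) (hwm 1) _ _
      · exact restrCoeff_mem (hwm 2) hvm _ _)
    (by
      rintro (j | j)
      · simp only [Sum.elim_inl]
        rw [← coeff_restr, h1]
        exact coeff_normalPoly_mem _ hbm _
      · simp only [Sum.elim_inr]
        rw [← coeff_restr, h2]
        exact coeff_normalPoly_mem _ hbm _)
  have h6 := this.1.lt_of_ne (fun h => hdep (this.2 h))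
  simp only [Fintype.card_fin, Fintype.card_prod, Fintype.card_sum] at h6
  omega

end Counting

/-! ### Forms with special zeros on some line -/

section NormalForm

variable {K : Type*} [Field K] {r d : ℕ}

theorem linearIndependent_pair_of_span_eq {V : Type*} [AddCommGroup V] [Module K V] {u v u' v' : V}
    (h : LinearIndependent K ![u, v])
    (hs : Submodule.span K {u', v'} = Submodule.span K {u, v}) : LinearIndependent K ![u', v'] := by
  rw [linearIndependent_iff_card_eq_finrank_span] at h ⊢
  rw [Set.finrank, Matrix.range_cons_cons_empty] at h ⊢
  rw [hs, ← h]

/-- Möbius transformations move three of the zeros of a binary form to `∞`, `0` and `-1`. The scalar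
factor is absorbed in the frame, since the ground field is algebraically closed. The other zeros `b`
of the normal form depend on the zeros `a` only, not on their multiplicities or on the form. -/
theorem exists_normal_frame [IsAlgClosed K] (hd : 0 < d) {j : ℕ} {a : Fin (j + 3) → K}
    (ha : Function.Injective a) :
    ∃ b : Fin j → K, ∀ (x : Exps r d → K) (u v : Fin (r + 1) → K) (c : K) (μ : Fin (j + 3) → ℕ),
      c ≠ 0 → (∀ s t : K, evalForm x (s • u + t • v) = c * ∏ i, (s - a i * t) ^ μ i) →
      ∃ u' v' : Fin (r + 1) → K, Submodule.span K {u', v'} = Submodule.span K {u, v} ∧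
        (∃ δ : K, δ ≠ 0 ∧ u' = δ • (a 0 • u + v)) ∧
        ∀ s t, evalForm x (s • u' + t • v') = normalForm μ b s t := by
  have h01 : a 0 - a 1 ≠ 0 := sub_ne_zero.2 (ha.ne (by simp))
  have h02 : a 0 - a 2 ≠ 0 := sub_ne_zero.2 (ha.ne (by simp [Fin.ext_iff, Nat.mod_eq_of_lt (show 2 < j + 3 by omega)]))
  have h12 : a 1 - a 2 ≠ 0 := sub_ne_zero.2 (ha.ne (by simp [Fin.ext_iff, Nat.mod_eq_of_lt (show 2 < j + 3 by omega)]))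
  have h0 : ∀ i : Fin j, a 0 - a i.succ.succ.succ ≠ 0 := fun i =>
    sub_ne_zero.2 (ha.ne (Fin.succ_ne_zero _).symm)
  set α := a 1 - a 2 with hα
  set β := a 0 - a 2 with hβ
  refine ⟨fun i => β * (a 1 - a i.succ.succ.succ) / (α * (a 0 - a i.succ.succ.succ)),
    fun x u v c μ hc h => ?_⟩
  set b : Fin j → K := fun i => β * (a 1 - a i.succ.succ.succ) / (α * (a 0 - a i.succ.succ.succ))
    with hb
  set κ : K := c * ((-β * (a 0 - a 1)) ^ μ 0 * ((α * (a 0 - a 1)) ^ μ 1 * ((α * β) ^ μ 2 *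
    ∏ i : Fin j, (α * (a 0 - a i.succ.succ.succ)) ^ μ i.succ.succ.succ))) with hκ
  have hκ0 : κ ≠ 0 := by
    refine mul_ne_zero hc (mul_ne_zero (pow_ne_zero _ (mul_ne_zero (neg_ne_zero.2 h02) h01))
      (mul_ne_zero (pow_ne_zero _ (mul_ne_zero h12 h01)) (mul_ne_zero
        (pow_ne_zero _ (mul_ne_zero h12 h02)) (Finset.prod_ne_zero_iff.2 fun i _ =>
          pow_ne_zero _ (mul_ne_zero h12 (h0 i))))))
  obtain ⟨γ, hγ⟩ := IsAlgClosed.exists_pow_nat_eq κ⁻¹ hd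
  have hγ0 : γ ≠ 0 := by
    rintro rfl
    rw [zero_pow hd.ne'] at hγ
    exact inv_ne_zero hκ0 hγ.symm
  refine ⟨(γ * α) • (a 0 • u + v), (γ * β) • (a 1 • u + v), ?_,
    ⟨γ * α, mul_ne_zero hγ0 h12, rfl⟩, fun s t => ?_⟩
  · apply le_antisymm
    · rw [Submodule.span_le]
      rintro _ (rfl | rfl)
      · exact Submodule.mem_span_pair.2 ⟨γ * α * a 0, γ * α, by module⟩
      · exact Submodule.mem_span_pair.2 ⟨γ * β * a 1, γ * β, by module⟩
    · rw [Submodule.span_le]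
      rintro _ (rfl | rfl)
      · refine Submodule.mem_span_pair.2
          ⟨(γ * α * (a 0 - a 1))⁻¹, -(γ * β * (a 0 - a 1))⁻¹, ?_⟩
        match_scalars <;> field_simp <;> ring
      · refine Submodule.mem_span_pair.2
          ⟨-a 1 * (γ * α * (a 0 - a 1))⁻¹, a 0 * (γ * β * (a 0 - a 1))⁻¹, ?_⟩
        match_scalars <;> field_simp <;> ring
  · have h1 : s • (γ * α) • (a 0 • u + v) + t • (γ * β) • (a 1 • u + v) =
        γ • ((s * α * a 0 + t * β * a 1) • u + (s * α + t * β) • v) := by module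
    rw [h1, evalForm_smul, hγ, h]
    have h2 : c * ∏ i, (s * α * a 0 + t * β * a 1 - a i * (s * α + t * β)) ^ μ i =
        κ * normalForm μ b s t := by
      rw [Fin.prod_univ_succ, Fin.prod_univ_succ, Fin.prod_univ_succ, hκ, normalForm]
      have e0 : s * α * a 0 + t * β * a 1 - a 0 * (s * α + t * β) = (-β * (a 0 - a 1)) * t := by
        ring
      have e1 : s * α * a 0 + t * β * a 1 - a (Fin.succ 0) * (s * α + t * β) =
          (α * (a 0 - a 1)) * s := by
        rw [show (Fin.succ 0 : Fin (j + 3)) = 1 from rfl]; ring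
      have e2 : s * α * a 0 + t * β * a 1 - a (Fin.succ (Fin.succ 0)) * (s * α + t * β) =
          (α * β) * (s + t) := by
        rw [show (Fin.succ (Fin.succ 0) : Fin (j + 3)) = 2 from rfl, hα, hβ]; ring
      have e3 : ∀ i : Fin j,
          s * α * a 0 + t * β * a 1 - a i.succ.succ.succ * (s * α + t * β) =
          (α * (a 0 - a i.succ.succ.succ)) * (s + b i * t) := by
        intro i
        have := h0 i
        rw [hb]
        field_simp
        ring
      simp only [e0, e1, e2, e3, mul_pow, Finset.prod_mul_distrib]
      rw [show (Fin.succ (Fin.succ 0) : Fin (j + 3)) = 2 from rfl,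
        show (Fin.succ 0 : Fin (j + 3)) = 1 from rfl]
      ring
    rw [h2, inv_mul_cancel_left₀ hκ0]

theorem restr_eq_normalPoly [Infinite K] {x : Exps r d → K} {u v : Fin (r + 1) → K} {j : ℕ}
    {μ : Fin (j + 3) → ℕ} {b : Fin j → K}
    (h : ∀ s t, evalForm x (s • u + t • v) = normalForm μ b s t) :
    restr x u v = normalPoly μ b := by
  refine Polynomial.funext fun s => ?_
  rw [eval_restr, eval_normalPoly, ← h, one_smul]

theorem restr_eq_zero [Infinite K] {x : Exps r d → K} {u v : Fin (r + 1) → K}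
    (h : ∀ s t : K, evalForm x (s • u + t • v) = 0) : restr x u v = 0 := by
  refine Polynomial.funext fun s => ?_
  rw [eval_restr, Polynomial.eval_zero, ← h s 1, one_smul]

end NormalForm

section Bad

variable {K : Type*} [Field K] {r d : ℕ}

/-- The form with coefficient vector `x` vanishes on some line, or has at most `m` distinct zeros on
it. Exponents `0` are allowed, so that the number of factors can be fixed. -/
def FewZeros (m : ℕ) (x : Exps r d → K) : Prop :=
  ∃ u v : Fin (r + 1) → K, LinearIndependent K ![u, v] ∧
    ∃ (a : Fin m → K) (c : K) (μ : Fin m → ℕ), Function.Injective a ∧ ∑ i, μ i = d ∧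
      ∀ s t : K, evalForm x (s • u + t • v) = c * ∏ i, (s - a i * t) ^ μ i

/-- The form with coefficient vector `x` has the same zeros on two distinct lines, in suitable
coordinates on them: they are the `m` distinct points `a_i`, with multiplicities `μ_i` and `μ'_i`. Of
these only the `μ'_i` are required to be positive, which suffices for the parameter counts. -/
def EquivalentZeros (m : ℕ) (x : Exps r d → K) : Prop :=
  ∃ u v u' v' : Fin (r + 1) → K, LinearIndependent K ![u, v] ∧ LinearIndependent K ![u', v'] ∧
    Submodule.span K {u, v} ≠ Submodule.span K {u', v'} ∧
    ∃ (a : Fin m → K) (c c' : K) (μ μ' : Fin m → ℕ), Function.Injective a ∧ c ≠ 0 ∧ c' ≠ 0 ∧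
      (∑ i, μ i = d ∧ ∑ i, μ' i = d ∧ ∀ i, 1 ≤ μ' i) ∧
      (∀ s t : K, evalForm x (s • u + t • v) = c * ∏ i, (s - a i * t) ^ μ i) ∧
      ∀ s t : K, evalForm x (s • u' + t • v') = c' * ∏ i, (s - a i * t) ^ μ' i

theorem FewZeros.smul {m : ℕ} {x : Exps r d → K} (h : FewZeros m x) (e : K) :
    FewZeros m (e • x) := by
  obtain ⟨u, v, huv, a, c, μ, ha, hμ, hx⟩ := h
  exact ⟨u, v, huv, a, e * c, μ, ha, hμ, fun s t => by rw [smul_evalForm, hx, mul_assoc]⟩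

theorem EquivalentZeros.smul {m : ℕ} {x : Exps r d → K} (h : EquivalentZeros m x) {e : K}
    (he : e ≠ 0) : EquivalentZeros m (e • x) := by
  obtain ⟨u, v, u', v', huv, huv', hne, a, c, c', μ, μ', ha, hc, hc', hμ, hx, hx'⟩ := h
  exact ⟨u, v, u', v', huv, huv', hne, a, e * c, e * c', μ, μ', ha, mul_ne_zero he hc,
    mul_ne_zero he hc', hμ, fun s t => by rw [smul_evalForm, hx, mul_assoc],
    fun s t => by rw [smul_evalForm, hx', mul_assoc]⟩

theorem finite_sum_eq (m d : ℕ) : {μ : Fin m → ℕ | ∑ i, μ i = d}.Finite :=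
  (Set.finite_Iic (fun _ => d)).subset fun μ hμ i => by
    rw [← show ∑ i, μ i = d from hμ]
    exact Finset.single_le_sum (fun _ _ => Nat.zero_le _) (Finset.mem_univ i)

/-- A form has enough zeros on every line, unless it lies in a thin set. -/
theorem thin_fewZeros [IsAlgClosed K] {j : ℕ} (hd0 : 0 < d) (hd : 2 * (r + 1) + j < d + 1) :
    Thin {x : Exps r d → K | FewZeros (j + 3) x} := by
  have : Infinite K := IsAlgClosed.instInfinite
  have h0 : Thin {x : Exps r d → K | ∃ w : Fin 2 → Fin (r + 1) → K, HasDual w ∧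
      restr x (w 0) (w 1) = 0} := by
    set A := {x : Exps r d → K | ∃ w : Fin 2 → Fin (r + 1) → K, HasDual w ∧
      restr x (w 0) (w 1) = 0}
    choose w hw hx using fun x : A => x.2
    choose ξ hξ using hw
    have := thin_restr_eq_zero (by omega) hξ hx
    rwa [Subtype.range_coe] at this
  have h1 : ∀ μ : Fin (j + 3) → ℕ, Thin {x : Exps r d → K |
      ∃ (w : Fin 2 → Fin (r + 1) → K) (b : Fin j → K), HasDual w ∧
        restr x (w 0) (w 1) = normalPoly μ b} := by
    intro μ
    set A := {x : Exps r d → K | ∃ (w : Fin 2 → Fin (r + 1) → K) (b : Fin j → K), HasDual w ∧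
        restr x (w 0) (w 1) = normalPoly μ b}
    choose w b hw hx using fun x : A => x.2
    choose ξ hξ using hw
    have := thin_restr_eq_normalPoly hd μ hξ hx
    rwa [Subtype.range_coe] at this
  refine (h0.union (Thin.biUnion (finite_sum_eq (j + 3) d) fun μ _ => h1 μ)).mono ?_
  rintro x ⟨u, v, huv, a, c, μ, ha, hμ, hx⟩
  by_cases hc : c = 0
  · refine Or.inl ⟨![u, v], hasDual_of_linearIndependent huv, restr_eq_zero fun s t => ?_⟩
    simp [hx, hc]
  · obtain ⟨b, hb⟩ := exists_normal_frame (r := r) hd0 ha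
    obtain ⟨u', v', hs, -, h⟩ := hb x u v c μ hc hx
    refine Or.inr (Set.mem_biUnion hμ ⟨![u', v'], b, hasDual_of_linearIndependent
      (linearIndependent_pair_of_span_eq huv hs), restr_eq_normalPoly h⟩)

/-- The first zero on the second line can be chosen off the first line, since the two lines have at
most one point in common. -/
theorem EquivalentZeros.exists_notMem {m : ℕ} {x : Exps r d → K} (h : EquivalentZeros (m + 2) x) :
    ∃ u v u' v' : Fin (r + 1) → K, LinearIndependent K ![u, v] ∧ LinearIndependent K ![u', v'] ∧
    ∃ (a : Fin (m + 2) → K) (c c' : K) (μ μ' : Fin (m + 2) → ℕ), Function.Injective a ∧ c ≠ 0 ∧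
      c' ≠ 0 ∧ (∑ i, μ i = d ∧ ∑ i, μ' i = d ∧ ∀ i, 1 ≤ μ' i) ∧
      (∀ s t : K, evalForm x (s • u + t • v) = c * ∏ i, (s - a i * t) ^ μ i) ∧
      (∀ s t : K, evalForm x (s • u' + t • v') = c' * ∏ i, (s - a i * t) ^ μ' i) ∧
      a 0 • u' + v' ∉ Submodule.span K {u, v} := by
  obtain ⟨u, v, u', v', huv, huv', hne, a, c, c', μ, μ', ha, hc, hc', ⟨hμ, hμ', hp⟩, hx, hx'⟩ := h
  by_cases h0 : a 0 • u' + v' ∉ Submodule.span K {u, v}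
  · exact ⟨u, v, u', v', huv, huv', a, c, c', μ, μ', ha, hc, hc', ⟨hμ, hμ', hp⟩, hx, hx', h0⟩
  rw [not_not] at h0
  have h1 : a 1 • u' + v' ∉ Submodule.span K {u, v} := by
    intro h1
    have hsub : a 0 - a 1 ≠ 0 := sub_ne_zero.2 (ha.ne (by simp))
    have hu' : u' ∈ Submodule.span K {u, v} := by
      have h2 := Submodule.smul_mem _ (a 0 - a 1)⁻¹ (sub_mem h0 h1)
      convert h2 using 1
      match_scalars <;> field_simp
      ring
    have hv' : v' ∈ Submodule.span K {u, v} := by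
      have h2 := sub_mem h0 (Submodule.smul_mem _ (a 0) hu')
      simpa using h2
    refine hne (Submodule.eq_of_le_of_finrank_eq ?_ ?_).symm
    · rw [Submodule.span_le]
      rintro _ (rfl | rfl) <;> assumption
    · rw [linearIndependent_iff_card_eq_finrank_span, Set.finrank,
        Matrix.range_cons_cons_empty] at huv huv'
      rw [← huv, ← huv']
  let σ : Equiv.Perm (Fin (m + 2)) := Equiv.swap 0 1
  refine ⟨u, v, u', v', huv, huv', a ∘ σ, c, c', μ ∘ σ, μ' ∘ σ, ha.comp σ.injective, hc, hc',
    ⟨?_, ?_, fun i => hp _⟩, fun s t => ?_, fun s t => ?_, ?_⟩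
  · rw [← hμ]; exact Equiv.sum_comp σ μ
  · rw [← hμ']; exact Equiv.sum_comp σ μ'
  · rw [hx]; congr 1; exact (Equiv.prod_comp σ (fun i => (s - a i * t) ^ μ i)).symm
  · rw [hx']; congr 1; exact (Equiv.prod_comp σ (fun i => (s - a i * t) ^ μ' i)).symm
  · simpa [σ] using h1

/-- A form has inequivalent zeros on distinct lines, unless it lies in a thin set. The lines are skew
or meet in a point, and the second case does not occur for `r < 2`. -/
theorem thin_equivalentZeros [IsAlgClosed K] [CharZero K] {j : ℕ} (hd0 : 0 < d)
    (hd : 4 * (r + 1) + j < 2 * (d + 1)) (hd' : 2 ≤ r → 3 * (r + 1) + (j + 3) ≤ 2 * d + 1) :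
    Thin {x : Exps r d → K | EquivalentZeros (j + 3) x} := by
  have : Infinite K := IsAlgClosed.instInfinite
  have h0 : ∀ μ μ' : Fin (j + 3) → ℕ, Thin {x : Exps r d → K |
      ∃ (w : Fin 4 → Fin (r + 1) → K) (b : Fin j → K), HasDual w ∧
        restr x (w 0) (w 1) = normalPoly μ b ∧ restr x (w 2) (w 3) = normalPoly μ' b} := by
    intro μ μ'
    set A := {x : Exps r d → K |
      ∃ (w : Fin 4 → Fin (r + 1) → K) (b : Fin j → K), HasDual w ∧
        restr x (w 0) (w 1) = normalPoly μ b ∧ restr x (w 2) (w 3) = normalPoly μ' b}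
    choose w b hw hx hx' using fun x : A => x.2
    choose ξ hξ using hw
    have := thin_skew hd0 hd μ μ' hξ hx hx'
    rwa [Subtype.range_coe] at this
  have h1 : ∀ μ μ' : Fin (j + 3) → ℕ, 1 ≤ μ' 1 → Thin {x : Exps r d → K |
      ∃ (w : Fin 3 → Fin (r + 1) → K) (v' : Fin (r + 1) → K) (b : Fin j → K) (α β γ : K),
        HasDual w ∧ HasDual ![w 2, v'] ∧ v' = α • w 0 + β • w 1 - γ • w 2 ∧
        normalForm μ b α β = normalForm μ' b γ 1 ∧
        restr x (w 0) (w 1) = normalPoly μ b ∧ restr x (w 2) v' = normalPoly μ' b} := by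
    intro μ μ' hμ'
    set A := {x : Exps r d → K |
      ∃ (w : Fin 3 → Fin (r + 1) → K) (v' : Fin (r + 1) → K) (b : Fin j → K) (α β γ : K),
        HasDual w ∧ HasDual ![w 2, v'] ∧ v' = α • w 0 + β • w 1 - γ • w 2 ∧
        normalForm μ b α β = normalForm μ' b γ 1 ∧
        restr x (w 0) (w 1) = normalPoly μ b ∧ restr x (w 2) v' = normalPoly μ' b}
    by_cases hr : 2 ≤ r
    · choose w v' b α β γ hw hw' hv' hr' hx hx' using fun x : A => x.2
      choose ξ hξ using hw
      choose η hη using hw'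
      have := thin_meet (hd' hr) μ μ' hμ' hξ hη hv' hr' hx hx'
      rwa [Subtype.range_coe] at this
    · refine ⟨1, one_ne_zero, ?_⟩
      rintro x ⟨w, -, -, -, -, -, hw, -⟩
      have := hw.card_le
      omega
  have hfin : {ν : (Fin (j + 3) → ℕ) × (Fin (j + 3) → ℕ) | ∑ i, ν.1 i = d ∧ ∑ i, ν.2 i = d ∧
      ∀ i, 1 ≤ ν.2 i}.Finite :=
    ((finite_sum_eq (j + 3) d).prod (finite_sum_eq (j + 3) d)).subset fun ν hν => ⟨hν.1, hν.2.1⟩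
  refine (Thin.biUnion hfin fun ν hν => (h0 ν.1 ν.2).union (h1 ν.1 ν.2 (hν.2.2 1))).mono ?_
  intro x hx
  obtain ⟨u, v, u', v', huv, huv', a, c, c', μ, μ', ha, hc, hc', hμ, hx, hx', hmem⟩ :=
    EquivalentZeros.exists_notMem hx
  refine Set.mem_biUnion (x := (μ, μ')) hμ ?_
  obtain ⟨b, hb⟩ := exists_normal_frame (r := r) hd0 ha
  obtain ⟨p, q, hs, -, h⟩ := hb x u v c μ hc hx
  obtain ⟨p', q', hs', ⟨δ, hδ, hp'⟩, h'⟩ := hb x u' v' c' μ' hc' hx'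
  have hpq := linearIndependent_pair_of_span_eq huv hs
  have hpq' := linearIndependent_pair_of_span_eq huv' hs'
  have hp'm : p' ∉ Submodule.span K {p, q} := by
    rw [hs, hp', Submodule.smul_mem_iff _ hδ]
    exact hmem
  by_cases hli : LinearIndependent K ![p, q, p', q']
  · exact Or.inl ⟨![p, q, p', q'], b, hasDual_of_linearIndependent hli, restr_eq_normalPoly h,
      restr_eq_normalPoly h'⟩
  right
  have hli3 : LinearIndependent K ![p, q, p'] := by
    rw [LinearIndependent.pair_iff] at hpq
    rw [Fintype.linearIndependent_iff]
    intro g hg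
    simp only [Fin.sum_univ_three, Matrix.cons_val] at hg
    have h2 : g 2 = 0 := by
      by_contra h2
      refine hp'm (Submodule.mem_span_pair.2 ⟨-(g 2)⁻¹ * g 0, -(g 2)⁻¹ * g 1, ?_⟩)
      have h3 := congrArg (fun z => (g 2)⁻¹ • z) hg
      simp only [smul_add, smul_zero, inv_smul_smul₀ h2] at h3
      rw [eq_comm, ← sub_eq_zero, ← h3]
      module
    rw [h2, zero_smul, add_zero] at hg
    obtain ⟨h3, h4⟩ := hpq _ _ hg
    intro i
    fin_cases i <;> assumption
  -- The two lines meet: a dependency of the four vectors, with nonzero coefficient of `q'`.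
  obtain ⟨g, hg, i, hi⟩ := Fintype.not_linearIndependent_iff.1 hli
  simp only [Fin.sum_univ_four, Matrix.cons_val] at hg
  have h3 : g 3 ≠ 0 := by
    intro h3
    rw [h3, zero_smul, add_zero] at hg
    have h4 := Fintype.linearIndependent_iff.1 hli3 ![g 0, g 1, g 2] (by
      simpa [Fin.sum_univ_three] using hg)
    apply hi
    fin_cases i
    · exact h4 0
    · exact h4 1
    · exact h4 2
    · exact h3
  have hq' : q' = (-(g 3)⁻¹ * g 0) • p + (-(g 3)⁻¹ * g 1) • q - ((g 3)⁻¹ * g 2) • p' := by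
    have h4 := congrArg (fun z => (g 3)⁻¹ • z) hg
    simp only [smul_add, smul_zero, inv_smul_smul₀ h3] at h4
    rw [← sub_eq_zero, ← h4]
    module
  refine ⟨![p, q, p'], q', b, -(g 3)⁻¹ * g 0, -(g 3)⁻¹ * g 1, (g 3)⁻¹ * g 2,
    hasDual_of_linearIndependent hli3, hasDual_of_linearIndependent hpq', hq', ?_,
    restr_eq_normalPoly h, restr_eq_normalPoly h'⟩
  rw [← h, ← h']
  congr 1
  conv_rhs => rw [hq']
  module

end Bad

/-! ### Collision of roots of monic polynomials -/

section Closure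

open Polynomial (C X)

variable {K : Type*} [Field K]

theorem monic_prod_X_sub_C_pow {R : Type*} [CommRing R] {k : ℕ} (a : Fin k → R) (m : Fin k → ℕ) :
    (∏ i, (X - C (a i)) ^ m i).Monic :=
  Polynomial.monic_prod_of_monic _ _ fun _ _ => (Polynomial.monic_X_sub_C _).pow _

theorem natDegree_prod_X_sub_C_pow {R : Type*} [CommRing R] [Nontrivial R] {k : ℕ} (a : Fin k → R)
    (m : Fin k → ℕ) : (∏ i, (X - C (a i)) ^ m i).natDegree = ∑ i, m i := by
  rw [Polynomial.natDegree_prod_of_monic _ _ fun i _ => (Polynomial.monic_X_sub_C _).pow _]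
  exact Finset.sum_congr rfl fun i _ => by
    rw [(Polynomial.monic_X_sub_C _).natDegree_pow, Polynomial.natDegree_X_sub_C, mul_one]

/-- Zariski closedness of the set of monic polynomials with given root multiplicities, roots being
allowed to collide: `K[a]` is integral over the subring generated by the coefficients of
`∏ (T - a_i) ^ m_i`, so every point of the closure lifts to a point `a`. -/
theorem exists_eq_prod_of_forall_eval_eq_zero [IsAlgClosed K] {k d : ℕ} {m : Fin k → ℕ}
    (hm : ∀ i, 1 ≤ m i) (hd : ∑ i, m i = d) (g : ℕ → K)
    (hg : ∀ P : MvPolynomial (Fin d) K,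
      (∀ a : Fin k → K, MvPolynomial.eval
        (fun j : Fin d => (∏ i, (X - C (a i)) ^ m i : Polynomial K).coeff j) P = 0) →
      MvPolynomial.eval (fun j : Fin d => g j) P = 0) :
    ∃ a : Fin k → K, ∀ j < d, g j = (∏ i, (X - C (a i)) ^ m i : Polynomial K).coeff j := by
  have hinf : Infinite K := IsAlgClosed.instInfinite
  let f : Polynomial (MvPolynomial (Fin k) K) := ∏ i, (X - C (MvPolynomial.X i)) ^ m i
  have hfm : f.Monic := monic_prod_X_sub_C_pow _ _
  have hfd : f.natDegree = d := (natDegree_prod_X_sub_C_pow _ _).trans hd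
  have hfa : ∀ a : Fin k → K, f.map (MvPolynomial.eval a) = ∏ i, (X - C (a i)) ^ m i := by
    intro a
    simp [f, Polynomial.map_prod]
  let ψ : MvPolynomial (Fin d) K →ₐ[K] MvPolynomial (Fin k) K :=
    MvPolynomial.aeval fun j : Fin d => f.coeff j
  have hψ : ∀ a P, MvPolynomial.eval a (ψ P) = MvPolynomial.eval
      (fun j : Fin d => (∏ i, (X - C (a i)) ^ m i : Polynomial K).coeff j) P := by
    intro a P
    induction P using MvPolynomial.induction_on with
    | C c => simp [ψ]
    | add p q hp hq => simp [hp, hq]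
    | mul_X p j hp =>
      rw [map_mul, map_mul, map_mul, hp, MvPolynomial.eval_X, ← hfa, Polynomial.coeff_map]
      simp [ψ]
  have hint : ψ.toRingHom.IsIntegral := by
    have hX : ∀ i, ψ.toRingHom.IsIntegralElem (MvPolynomial.X i) := by
      intro i
      have hlift : f ∈ Polynomial.lifts ψ.toRingHom := by
        rw [Polynomial.lifts_iff_coeff_lifts]
        intro j
        rcases lt_trichotomy j d with hj | hj | hj
        · exact ⟨MvPolynomial.X ⟨j, hj⟩, by simp [ψ]⟩
        · refine ⟨1, ?_⟩
          rw [map_one, hj, ← hfd]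
          exact hfm.symm
        · refine ⟨0, ?_⟩
          rw [map_zero, Polynomial.coeff_eq_zero_of_natDegree_lt (by omega)]
      obtain ⟨q, hq, -, hqm⟩ := Polynomial.lifts_and_natDegree_eq_and_monic hlift hfm
      refine ⟨q, hqm, ?_⟩
      rw [← Polynomial.eval_map, hq, Polynomial.eval_prod]
      refine Finset.prod_eq_zero (Finset.mem_univ i) ?_
      simp [zero_pow (show m i ≠ 0 by have := hm i; omega)]
    intro p
    induction p using MvPolynomial.induction_on with
    | C c =>
      have : (MvPolynomial.C c : MvPolynomial (Fin k) K) = ψ.toRingHom (MvPolynomial.C c) := by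
        simp [ψ]
      rw [this]
      exact RingHom.isIntegralElem_map _
    | add p q hp hq => exact hp.add _ hq
    | mul_X p i hp => exact hp.mul _ (hX i)
  let Mg : Ideal (MvPolynomial (Fin d) K) := RingHom.ker (MvPolynomial.eval fun j : Fin d => g j)
  have hMg : Mg.IsMaximal := RingHom.ker_isMaximal_of_surjective _ fun c =>
    ⟨MvPolynomial.C c, by simp⟩
  let _ : Algebra (MvPolynomial (Fin d) K) (MvPolynomial (Fin k) K) := ψ.toRingHom.toAlgebra
  have : Algebra.IsIntegral (MvPolynomial (Fin d) K) (MvPolynomial (Fin k) K) := ⟨hint⟩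
  obtain ⟨Q, hQ, hQM⟩ := Ideal.exists_ideal_over_maximal_of_isIntegral
    (S := MvPolynomial (Fin k) K) Mg (by
      intro P hP
      have hP0 : ψ P = 0 := hP
      exact hg P fun a => by rw [← hψ, hP0, map_zero])
  obtain ⟨a, rfl⟩ := MvPolynomial.isMaximal_iff_eq_vanishingIdeal_singleton.1 hQ
  refine ⟨a, fun j hj => ?_⟩
  have h1 : MvPolynomial.X ⟨j, hj⟩ - MvPolynomial.C (g j) ∈ Mg := by
    simp [Mg, RingHom.mem_ker]
  rw [← hQM] at h1
  have h2 : MvPolynomial.eval a (ψ (MvPolynomial.X ⟨j, hj⟩ - MvPolynomial.C (g j))) = 0 := by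
    have := (MvPolynomial.mem_vanishingIdeal_singleton_iff (K := K) a _).1 h1
    rwa [MvPolynomial.aeval_eq_eval] at this
  rw [hψ] at h2
  exact (sub_eq_zero.1 (by simpa using h2)).symm

end Closure

/-! ### Hypersurfaces and lines -/

section Geometry

open Polynomial (C X)

variable {K : Type*} [Field K] {r d k : ℕ}

/-- The coefficient vector of a form. -/
def coeffVec (F : Form K r d) : Exps r d → K := fun e => coeffs F e.1

theorem evalForm_coeffVec (F : Form K r d) (w : Fin (r + 1) → K) :
    evalForm (coeffVec F) w = MvPolynomial.eval w F.1 :=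
  evalForm_coeff (RingHom.id K) ((MvPolynomial.mem_homogeneousSubmodule _ _).1 F.2) w

theorem coeffVec_smul (c : K) (F : Form K r d) : coeffVec (c • F) = c • coeffVec F := by
  ext e
  simp [coeffVec, coeffs]

/-- An equation of a hypersurface is a multiple of the chosen one. -/
theorem exists_rep_eq_smul {F : Form K r d} {X : Hypersurface K r d}
    (h : ∃ hF : F ≠ 0, Projectivization.mk K F hF = X) :
    ∃ a : K, a ≠ 0 ∧ ∀ w, MvPolynomial.eval w X.rep.1 = a * evalForm (coeffVec F) w := by
  obtain ⟨hF, rfl⟩ := h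
  obtain ⟨a, ha⟩ := Projectivization.exists_smul_eq_mk_rep K F hF
  refine ⟨a, a.ne_zero, fun w => ?_⟩
  rw [← ha, ← evalForm_coeffVec, show a • F = (a : K) • F from rfl, coeffVec_smul, smul_evalForm]

theorem mem_interSet_mk {X : Hypersurface K r d} {ℓ : Line K r} {w : ℓ.1} (hw : w ≠ 0) :
    Projectivization.mk K w hw ∈ interSet X ℓ ↔
      evalForm (coeffVec X.rep) (w : Fin (r + 1) → K) = 0 := by
  rw [evalForm_coeffVec]
  constructor
  · intro h
    exact h w (by rw [Projectivization.submodule_mk]; exact Submodule.mem_span_singleton_self _)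
  · intro h z hz
    rw [Projectivization.submodule_mk, Submodule.mem_span_singleton] at hz
    obtain ⟨a, rfl⟩ := hz
    rw [← evalForm_coeffVec] at h ⊢
    rw [Submodule.coe_smul, evalForm_smul, h, mul_zero]

theorem Represents.linearIndependent {F : Form K r d} {u v : Fin (r + 1) → K}
    {z : Hypersurface K r d × Line K r} (h : Represents F u v z) : LinearIndependent K ![u, v] := by
  rw [linearIndependent_iff_card_eq_finrank_span, Set.finrank, Matrix.range_cons_cons_empty, h.2,
    z.2.2, Fintype.card_fin]

theorem Represents.mem {F : Form K r d} {u v : Fin (r + 1) → K}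
    {z : Hypersurface K r d × Line K r} (h : Represents F u v z) (s t : K) :
    s • u + t • v ∈ z.2.1 := by
  rw [← h.2]
  exact Submodule.mem_span_pair.2 ⟨s, t, rfl⟩

/-- A nonzero vector of a line is part of a basis. -/
theorem exists_represents (X : Hypersurface K r d) (ℓ : Line K r) {u : Fin (r + 1) → K}
    (hu : u ∈ ℓ.1) (hu0 : u ≠ 0) : ∃ v, Represents X.rep u v (X, ℓ) := by
  have hle : Submodule.span K {u} ≤ ℓ.1 := by
    rw [Submodule.span_le]; rintro _ rfl; exact hu
  have hlt : Submodule.span K {u} < ℓ.1 := by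
    refine lt_of_le_of_ne hle fun h => ?_
    have h1 := finrank_span_singleton (K := K) hu0
    rw [h, ℓ.2] at h1
    omega
  obtain ⟨v, hv, hvu⟩ := SetLike.exists_of_lt hlt
  have hli : LinearIndependent K ![u, v] := by
    rw [LinearIndependent.pair_iff' hu0]
    rintro a rfl
    exact hvu (Submodule.mem_span_singleton.2 ⟨a, rfl⟩)
  refine ⟨v, ⟨X.rep_nonzero, X.mk_rep⟩, Submodule.eq_of_le_of_finrank_eq ?_ ?_⟩
  · rw [Submodule.span_le]
    rintro _ (rfl | rfl) <;> assumption
  · rw [linearIndependent_iff_card_eq_finrank_span, Set.finrank,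
      Matrix.range_cons_cons_empty] at hli
    rw [← hli, ℓ.2, Fintype.card_fin]

/-- The zeros of an equation on a line, in the coordinates of a frame whose first vector is not a
zero. -/
theorem exists_zeros_of_mem_openIncidence {m : MultVector k d} {z : Hypersurface K r d × Line K r}
    (h : z ∈ openIncidence r m) {F : Form K r d} {u v : Fin (r + 1) → K} (hR : Represents F u v z)
    (hu : evalForm (coeffVec F) u ≠ 0) :
    ∃ a : Fin k → K, Function.Injective a ∧ ∀ s t : K, evalForm (coeffVec F) (s • u + t • v) =
      evalForm (coeffVec F) u * ∏ i, (s - a i * t) ^ m.val i := by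
  obtain ⟨p, hp, c, L, hc, hL, hF⟩ := h
  obtain ⟨e, he, heF⟩ := exists_rep_eq_smul hR.1
  let U : z.2.1 := ⟨u, by simpa using hR.mem 1 0⟩
  let V : z.2.1 := ⟨v, by simpa using hR.mem 0 1⟩
  have hval : ∀ s t : K, evalForm (coeffVec F) (s • u + t • v) =
      e⁻¹ * (c * ∏ i, (s * L i U + t * L i V) ^ m.val i) := by
    intro s t
    have h1 := hF (s • U + t • V)
    have h2 := heF (s • u + t • v)
    rw [show ((s • U + t • V : z.2.1) : Fin (r + 1) → K) = s • u + t • v from rfl, h2] at h1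
    simp only [map_add, map_smul, smul_eq_mul] at h1
    rw [← h1, inv_mul_cancel_left₀ he]
  have hval0 : evalForm (coeffVec F) u = e⁻¹ * (c * ∏ i, L i U ^ m.val i) := by
    have := hval 1 0
    simpa using this
  have hLU : ∀ i, L i U ≠ 0 := by
    intro i hi
    apply hu
    rw [hval0, Finset.prod_eq_zero (Finset.mem_univ i), mul_zero, mul_zero]
    rw [hi, zero_pow (by have := m.pos i; omega)]
  have hfac : ∀ i (s t : K), s * L i U + t * L i V = L i U * (s - -(L i V / L i U) * t) := by
    intro i s t
    have := hLU i
    field_simp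
    ring
  refine ⟨fun i => -(L i V / L i U), fun i j hij => hp ?_, fun s t => ?_⟩
  · apply Projectivization.submodule_injective
    rw [← hL i, ← hL j]
    have hij' : -(L i V / L i U) = -(L j V / L j U) := hij
    ext ⟨w, hw⟩
    rw [← hR.2] at hw
    obtain ⟨s, t, hst⟩ := Submodule.mem_span_pair.1 hw
    have hwe : ∀ hw', (⟨w, hw'⟩ : z.2.1) = s • U + t • V := fun _ => Subtype.ext hst.symm
    rw [hwe, LinearMap.mem_ker, LinearMap.mem_ker]
    simp only [map_add, map_smul, smul_eq_mul]
    rw [hfac i, hfac j, hij']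
    simp [hLU]
  · rw [hval, hval0]
    simp only [hfac, mul_pow, Finset.prod_mul_distrib]
    ring

theorem mem_openIncidence_of_zeros {m : MultVector k d} {z : Hypersurface K r d × Line K r}
    {F : Form K r d} {u v : Fin (r + 1) → K} (hR : Represents F u v z) {a : Fin k → K}
    (ha : Function.Injective a) {c : K} (hc : c ≠ 0)
    (h : ∀ s t : K, evalForm (coeffVec F) (s • u + t • v) = c * ∏ i, (s - a i * t) ^ m.val i) :
    z ∈ openIncidence r m := by
  obtain ⟨e, he, heF⟩ := exists_rep_eq_smul hR.1
  have hli := hR.linearIndependent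
  let U : z.2.1 := ⟨u, by simpa using hR.mem 1 0⟩
  let V : z.2.1 := ⟨v, by simpa using hR.mem 0 1⟩
  have hliUV : LinearIndependent K ![U, V] := by
    rw [LinearIndependent.pair_iff] at hli ⊢
    intro s t hst
    exact hli s t (congrArg Subtype.val hst)
  have hspan : ⊤ ≤ Submodule.span K (Set.range ![U, V]) := by
    rintro ⟨w, hw⟩ -
    rw [← hR.2] at hw
    obtain ⟨s, t, hst⟩ := Submodule.mem_span_pair.1 hw
    rw [Matrix.range_cons_cons_empty]
    exact Submodule.mem_span_pair.2 ⟨s, t, Subtype.ext hst⟩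
  let b := Module.Basis.mk hliUV hspan
  have hb0 : b 0 = U := by simp [b]
  have hb1 : b 1 = V := by simp [b]
  let L : Fin k → Module.Dual K z.2.1 := fun i => b.coord 0 - a i • b.coord 1
  have hL : ∀ i s t, L i (s • U + t • V) = s - a i * t := by
    intro i s t
    rw [← hb0, ← hb1]
    simp [L]
  have hw : ∀ w : z.2.1, ∃ s t : K, w = s • U + t • V := by
    rintro ⟨w, hw⟩
    rw [← hR.2] at hw
    obtain ⟨s, t, hst⟩ := Submodule.mem_span_pair.1 hw
    exact ⟨s, t, Subtype.ext hst.symm⟩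
  have hne : ∀ i, a i • U + V ≠ 0 := by
    intro i h0
    have := (LinearIndependent.pair_iff.1 hliUV (a i) 1 (by rwa [one_smul])).2
    exact one_ne_zero this
  have hker : ∀ i, LinearMap.ker (L i) =
      (Projectivization.mk K (a i • U + V) (hne i)).submodule := by
    intro i
    rw [Projectivization.submodule_mk]
    ext w
    obtain ⟨s, t, rfl⟩ := hw w
    rw [LinearMap.mem_ker, hL, Submodule.mem_span_singleton]
    constructor
    · intro h0
      refine ⟨t, ?_⟩
      rw [sub_eq_zero.1 h0]
      module
    · rintro ⟨t', ht'⟩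
      rw [← hL, ← ht', map_smul]
      have := hL i (a i) 1
      rw [one_smul, mul_one, sub_self] at this
      rw [this, smul_zero]
  refine ⟨fun i => Projectivization.mk K (a i • U + V) (hne i), fun i j hij => ?_, e * c, L,
    mul_ne_zero he hc, hker, fun w => ?_⟩
  · have h1 : LinearMap.ker (L i) = LinearMap.ker (L j) := by
      rw [hker, hker]
      exact congrArg Projectivization.submodule hij
    have h2 : a i • U + (1 : K) • V ∈ LinearMap.ker (L i) := by
      rw [LinearMap.mem_ker, hL]; ring
    rw [h1, LinearMap.mem_ker, hL, mul_one] at h2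
    exact ha (sub_eq_zero.1 h2)
  · obtain ⟨s, t, rfl⟩ := hw w
    rw [heF, show ((s • U + t • V : z.2.1) : Fin (r + 1) → K) = s • u + t • v from rfl, h]
    simp only [hL]
    ring

/-- A factorization of the dehomogenized form gives one of the binary form. -/
theorem evalForm_eq_of_restr_eq {x : Exps r d → K} {u v : Fin (r + 1) → K} {a : Fin k → K}
    {m : Fin k → ℕ} (hm : ∑ i, m i = d)
    (h : restr x u v = C (evalForm x u) * ∏ i, (X - C (a i)) ^ m i) (s t : K) :
    evalForm x (s • u + t • v) = evalForm x u * ∏ i, (s - a i * t) ^ m i := by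
  by_cases ht : t = 0
  · subst ht
    simp [evalForm_smul, Finset.prod_pow_eq_pow_sum, hm, mul_comm]
  · have h1 : s • u + t • v = t • ((s / t) • u + v) := by
      rw [smul_add, smul_smul, mul_div_cancel₀ _ ht]
    rw [h1, evalForm_smul, ← eval_restr, h, Polynomial.eval_mul, Polynomial.eval_C,
      Polynomial.eval_prod, mul_left_comm]
    have h2 : t ^ d = ∏ i, t ^ m i := by rw [Finset.prod_pow_eq_pow_sum, hm]
    rw [h2, ← Finset.prod_mul_distrib]
    congr 1
    refine Finset.prod_congr rfl fun i _ => ?_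
    rw [Polynomial.eval_pow, ← mul_pow]
    congr 1
    simp only [Polynomial.eval_sub, Polynomial.eval_X, Polynomial.eval_C]
    field_simp

theorem restr_eq_of_evalForm_eq [Infinite K] {x : Exps r d → K} {u v : Fin (r + 1) → K} {c : K}
    {a : Fin k → K} {m : Fin k → ℕ}
    (h : ∀ s t : K, evalForm x (s • u + t • v) = c * ∏ i, (s - a i * t) ^ m i) :
    restr x u v = C c * ∏ i, (X - C (a i)) ^ m i := by
  refine Polynomial.funext fun s => ?_
  have := h s 1
  rw [one_smul] at this
  rw [eval_restr, this]
  simp [Polynomial.eval_prod]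

/-- The polynomial `P` homogenized by `G`, with one factor `G` to spare so that it vanishes where
`G` does. -/
noncomputable def homogenizeBy {R : Type*} [CommRing R] [Algebra K R] (P : MvPolynomial (Fin d) K)
    (G : R) (c : Fin d → R) : R :=
  ∑ e ∈ P.support, algebraMap K R (P.coeff e) *
    (G ^ (P.totalDegree + 1 - ∑ j, e j) * ∏ j, c j ^ e j)

theorem map_homogenizeBy {R S : Type*} [CommRing R] [Algebra K R] [CommRing S] [Algebra K S]
    (φ : R →ₐ[K] S) (P : MvPolynomial (Fin d) K) (G : R) (c : Fin d → R) :
    φ (homogenizeBy P G c) = homogenizeBy P (φ G) (fun j => φ (c j)) := by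
  simp [homogenizeBy]

theorem homogenizeBy_eq (P : MvPolynomial (Fin d) K) (G : K) (c : Fin d → K) :
    homogenizeBy P G c =
      G ^ (P.totalDegree + 1) * MvPolynomial.eval (fun j => c j / G) P := by
  have hdeg : ∀ e ∈ P.support, ∑ j, e j ≤ P.totalDegree := by
    intro e he
    have := MvPolynomial.le_totalDegree he
    rwa [Finsupp.sum_fintype _ _ (by simp)] at this
  by_cases hG : G = 0
  · subst hG
    rw [zero_pow (by omega), zero_mul]
    refine Finset.sum_eq_zero fun e he => ?_
    rw [zero_pow (by have := hdeg e he; omega)]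
    simp
  · rw [MvPolynomial.eval_eq', Finset.mul_sum]
    refine Finset.sum_congr rfl fun e he => ?_
    have h1 : G ^ (P.totalDegree + 1) = G ^ (P.totalDegree + 1 - ∑ j, e j) * ∏ j, G ^ e j := by
      rw [Finset.prod_pow_eq_pow_sum, ← pow_add]
      congr 1
      have := hdeg e he
      omega
    have h2 : ∏ j, c j ^ e j = (∏ j, G ^ e j) * ∏ j, (c j / G) ^ e j := by
      rw [← Finset.prod_mul_distrib]
      refine Finset.prod_congr rfl fun j _ => ?_
      rw [← mul_pow, mul_div_cancel₀ _ hG]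
    rw [h1, h2, Algebra.algebraMap_self, RingHom.id_apply]
    ring

/-- On a line in the closure the equation still splits with the prescribed multiplicities, although
zeros may collide, as long as it does not vanish on the line. -/
theorem exists_zeros_of_mem_incidence [IsAlgClosed K] {m : MultVector k d}
    {z : Hypersurface K r d × Line K r} (h : z ∈ incidence r m) {F : Form K r d}
    {u v : Fin (r + 1) → K} (hR : Represents F u v z) (hu : evalForm (coeffVec F) u ≠ 0) :
    ∃ a : Fin k → K, ∀ s t : K, evalForm (coeffVec F) (s • u + t • v) =
      evalForm (coeffVec F) u * ∏ i, (s - a i * t) ^ m.val i := by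
  have : Infinite K := IsAlgClosed.instInfinite
  -- The coefficients of the restriction, as polynomials in the coordinates of `(F, u, v)`.
  let ρ : Polynomial (MvPolynomial ((Fin (r + 1) →₀ ℕ) ⊕ (Fin (r + 1) ⊕ Fin (r + 1))) K) :=
    restr (fun e : Exps r d => .X (.inl e.1)) (fun i => .X (.inr (.inl i)))
      (fun i => .X (.inr (.inr i)))
  have hρ : ∀ (F : Form K r d) u v j, MvPolynomial.eval (frameCoords F u v) (ρ.coeff j) =
      (restr (coeffVec F) u v).coeff j := by
    intro F u v j
    rw [← Polynomial.coeff_map, map_restr]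
    simp only [MvPolynomial.eval_X]
    rfl
  have hΦ : ∀ P (F : Form K r d) u v, MvPolynomial.eval (frameCoords F u v)
      (homogenizeBy P (ρ.coeff d) (fun j : Fin d => ρ.coeff j)) =
      evalForm (coeffVec F) u ^ (P.totalDegree + 1) * MvPolynomial.eval
        (fun j : Fin d => (restr (coeffVec F) u v).coeff j / evalForm (coeffVec F) u) P := by
    intro P F u v
    have := map_homogenizeBy (MvPolynomial.aeval (frameCoords F u v)) P (ρ.coeff d)
      (fun j : Fin d => ρ.coeff j)
    simp only [MvPolynomial.aeval_eq_eval] at this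
    simp only [hρ, coeff_restr_top] at this
    rw [← homogenizeBy_eq]
    exact this
  obtain ⟨a, ha⟩ := exists_eq_prod_of_forall_eval_eq_zero m.pos m.sum_eq
    (fun j => (restr (coeffVec F) u v).coeff j / evalForm (coeffVec F) u) (by
      intro P hP
      have h1 := h (homogenizeBy P (ρ.coeff d) (fun j : Fin d => ρ.coeff j)) (by
        intro y hy F' u' v' hR'
        rw [hΦ]
        by_cases hu' : evalForm (coeffVec F') u' = 0
        · rw [hu', zero_pow (by omega), zero_mul]
        obtain ⟨a, -, ha⟩ := exists_zeros_of_mem_openIncidence hy hR' hu'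
        rw [restr_eq_of_evalForm_eq ha]
        simp only [Polynomial.coeff_C_mul, mul_div_cancel_left₀ _ hu']
        rw [hP, mul_zero]) F u v hR
      rw [hΦ] at h1
      exact (mul_eq_zero.1 h1).resolve_left (pow_ne_zero _ hu))
  refine ⟨a, fun s t => evalForm_eq_of_restr_eq m.sum_eq ?_ s t⟩
  have hmon := monic_prod_X_sub_C_pow a m.val
  have hdeg := (natDegree_prod_X_sub_C_pow a m.val).trans m.sum_eq
  ext j
  rw [Polynomial.coeff_C_mul]
  rcases lt_trichotomy j d with hj | hj | hj
  · rw [← ha j hj, mul_div_cancel₀ _ hu]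
  · have : (∏ i, (X - C (a i)) ^ m.val i : Polynomial K).coeff j = 1 := by
      rw [hj]
      have h2 := hmon.coeff_natDegree
      rwa [hdeg] at h2
    rw [this, hj, coeff_restr_top, mul_one]
  · rw [Polynomial.coeff_eq_zero_of_natDegree_lt (by have := natDegree_restr_le (coeffVec F) u v; omega),
      Polynomial.coeff_eq_zero_of_natDegree_lt (by omega), mul_zero]

end Geometry

/-! ### The Zariski open set of general hypersurfaces -/

section Main

variable {K : Type*} [Field K] {r d : ℕ}

/-- Coincidences among the zeros leave few distinct zeros. -/
theorem fewZeros_of_not_injective [Infinite K] {m : ℕ} {x : Exps r d → K} {u v : Fin (r + 1) → K}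
    (huv : LinearIndependent K ![u, v]) {a : Fin (m + 1) → K} (ha : ¬ Function.Injective a) {c : K}
    {μ : Fin (m + 1) → ℕ} (hμ : ∑ i, μ i = d)
    (h : ∀ s t : K, evalForm x (s • u + t • v) = c * ∏ i, (s - a i * t) ^ μ i) :
    FewZeros m x := by
  classical
  have hcard : (Finset.univ.image a).card ≤ m := by
    by_contra hlt
    have hinj : Set.InjOn a (Finset.univ : Finset (Fin (m + 1))) :=
      Finset.card_image_iff.1 (le_antisymm Finset.card_image_le (by
        rw [Finset.card_univ, Fintype.card_fin]
        omega))
    exact ha (by simpa using hinj)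
  obtain ⟨A, hA, hAc⟩ := Infinite.exists_superset_card_eq _ m hcard
  let e : Fin m ≃ A := (Fintype.equivFinOfCardEq (by simpa using hAc)).symm
  have hfib : ∀ i ∈ Finset.univ, a i ∈ A :=
    fun i _ => hA (Finset.mem_image_of_mem _ (Finset.mem_univ i))
  refine ⟨u, v, huv, fun i => e i, c, fun i => ∑ l with a l = e i, μ l,
    Subtype.val_injective.comp e.injective, ?_, fun s t => ?_⟩
  · rw [← hμ, ← Finset.sum_fiberwise_of_maps_to hfib, ← Finset.sum_coe_sort A]
    exact Equiv.sum_comp e (fun z : A => ∑ l with a l = z, μ l)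
  · rw [h, ← Finset.prod_fiberwise_of_maps_to hfib, ← Finset.prod_coe_sort A]
    congr 1
    rw [← Equiv.prod_comp e]
    refine Finset.prod_congr rfl fun i _ => ?_
    rw [← Finset.prod_pow_eq_pow_sum]
    refine Finset.prod_congr rfl fun l hl => ?_
    rw [(Finset.mem_filter.1 hl).2]

/-- A form that has enough zeros on every line in the sense of `FewZeros` does not vanish identically on any. -/
theorem exists_ne_zero_of_not_fewZeros [Infinite K] {m : ℕ} (hm : 0 < m) {X : Hypersurface K r d}
    (h : ¬ FewZeros m (coeffVec X.rep)) (ℓ : Line K r) :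
    ∃ u v, Represents X.rep u v (X, ℓ) ∧ evalForm (coeffVec X.rep) u ≠ 0 := by
  by_contra! hc
  obtain ⟨u₀, hu₀⟩ : ∃ u : ℓ.1, u ≠ 0 := by
    have : Nontrivial ℓ.1 := Module.nontrivial_of_finrank_pos (R := K) (by rw [ℓ.2]; norm_num)
    exact exists_ne 0
  obtain ⟨v, hR⟩ := exists_represents X ℓ u₀.2 (by simpa using hu₀)
  have hz : ∀ w ∈ ℓ.1, evalForm (coeffVec X.rep) w = 0 := by
    intro w hw
    by_cases hw0 : w = 0
    · rw [hw0, ← zero_smul K (u₀ : Fin (r + 1) → K), evalForm_smul, hc _ _ hR, mul_zero]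
    · obtain ⟨v', hv'⟩ := exists_represents X ℓ hw hw0
      exact hc w v' hv'
  refine h ⟨u₀, v, hR.linearIndependent, fun i => Infinite.natEmbedding K i, 0,
    Pi.single ⟨0, hm⟩ d, fun i l hil => Fin.ext ((Infinite.natEmbedding K).injective hil), by simp,
    fun s t => ?_⟩
  rw [hz _ (hR.mem s t), zero_mul]

/-- An isomorphism of two lines that matches the zeros carries a frame of the first line to a frame of
the second in which the zeros have the same coordinates. -/
theorem ne_of_mem_openIncidence [IsAlgClosed K] {j : ℕ} {m : MultVector (j + 4) d}
    {X : Hypersurface K r d} (h1 : ¬ FewZeros (j + 3) (coeffVec X.rep))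
    (h2 : ¬ EquivalentZeros (j + 4) (coeffVec X.rep)) {ℓ ℓ' : Line K r}
    (h : (X, ℓ) ∈ openIncidence r m) (h' : (X, ℓ') ∈ openIncidence r m) (hne : ℓ ≠ ℓ') :
    crossRatioMap r m ⟨(X, ℓ), h⟩ ≠ crossRatioMap r m ⟨(X, ℓ'), h'⟩ := by
  have : Infinite K := IsAlgClosed.instInfinite
  intro heq
  obtain ⟨e, he⟩ := (moduliPoint_eq_iff (isIncident_of_mem h) (isIncident_of_mem h')).1 heq
  have hzero : ∀ w : ℓ.1, w ≠ 0 → (evalForm (coeffVec X.rep) (w : Fin (r + 1) → K) = 0 ↔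
      evalForm (coeffVec X.rep) (e w : Fin (r + 1) → K) = 0) := by
    intro w hw
    have hew : e w ≠ 0 := by simpa using hw
    rw [← mem_interSet_mk hw, ← mem_interSet_mk hew, ← he]
    exact ((Projectivization.map_injective e.toLinearMap e.injective).mem_set_image
      (a := Projectivization.mk K w hw)).symm
  obtain ⟨u, v, hR, hu⟩ := exists_ne_zero_of_not_fewZeros (by omega) h1 ℓ
  let U : ℓ.1 := ⟨u, by simpa using hR.mem 1 0⟩
  let V : ℓ.1 := ⟨v, by simpa using hR.mem 0 1⟩
  have hli := hR.linearIndependent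
  have hst : ∀ s t : K, s • U + t • V = 0 → s = 0 ∧ t = 0 := fun s t hst =>
    LinearIndependent.pair_iff.1 hli s t (congrArg Subtype.val hst)
  have hR' : Represents X.rep (e U : Fin (r + 1) → K) (e V) (X, ℓ') := by
    refine ⟨hR.1, ?_⟩
    have hUV : Submodule.span K {U, V} = ⊤ := by
      rw [eq_top_iff]
      rintro ⟨w, hw⟩ -
      have hw' : w ∈ Submodule.span K {u, v} := by rw [hR.2]; exact hw
      obtain ⟨s, t, hst⟩ := Submodule.mem_span_pair.1 hw'
      exact Submodule.mem_span_pair.2 ⟨s, t, Subtype.ext hst⟩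
    have := congrArg (fun W => Submodule.map (ℓ'.1.subtype ∘ₗ e.toLinearMap) W) hUV
    simp only [Submodule.map_span, Set.image_pair, Submodule.map_top] at this
    rw [LinearMap.range_comp, LinearEquiv.range, Submodule.map_top, Submodule.range_subtype] at this
    exact this
  have hU0 : U ≠ 0 := by
    intro h0
    have := (hst 1 0 (by rw [h0]; simp)).1
    exact one_ne_zero this
  have hu' : evalForm (coeffVec X.rep) (e U : Fin (r + 1) → K) ≠ 0 := fun h0 =>
    hu ((hzero U hU0).2 h0)
  obtain ⟨a, ha, hF⟩ := exists_zeros_of_mem_openIncidence h hR hu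
  obtain ⟨a', ha', hF'⟩ := exists_zeros_of_mem_openIncidence h' hR' hu'
  have hex : ∀ i, ∃ l, a' l = a i := by
    intro i
    have h3 : evalForm (coeffVec X.rep) ((a i • U + (1 : K) • V : ℓ.1) : Fin (r + 1) → K) = 0 := by
      have := hF (a i) 1
      rw [Finset.prod_eq_zero (Finset.mem_univ i), mul_zero] at this
      · exact this
      · rw [mul_one, sub_self, zero_pow (by have := m.pos i; omega)]
    rw [hzero _ (fun h0 => one_ne_zero (hst _ _ h0).2), map_add, map_smul, map_smul] at h3
    have h4 := hF' (a i) 1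
    rw [show a i • (e U : Fin (r + 1) → K) + (1 : K) • (e V : Fin (r + 1) → K) =
      ((a i • e U + (1 : K) • e V : ℓ'.1) : Fin (r + 1) → K) from rfl, h3] at h4
    obtain ⟨l, -, hl⟩ := Finset.prod_eq_zero_iff.1 ((mul_eq_zero.1 h4.symm).resolve_left hu')
    refine ⟨l, ?_⟩
    have := pow_eq_zero_iff (by have := m.pos l; omega) |>.1 hl
    rw [mul_one, sub_eq_zero] at this
    exact this.symm
  choose π hπ using hex
  have hπi : Function.Injective π := fun i l hil => ha (by rw [← hπ, ← hπ, hil])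
  let σ : Equiv.Perm (Fin (j + 4)) := Equiv.ofBijective π (Finite.injective_iff_bijective.1 hπi)
  refine h2 ⟨u, v, e U, e V, hli, hR'.linearIndependent, ?_, a, _, _, m.val, m.val ∘ σ, ha, hu, hu',
    ⟨m.sum_eq, ?_, fun i => m.pos _⟩, hF, fun s t => ?_⟩
  · rw [hR.2, hR'.2]
    exact fun h0 => hne (Subtype.ext h0)
  · exact (Equiv.sum_comp σ m.val).trans m.sum_eq
  · rw [hF', ← Equiv.prod_comp σ]
    congr 1
    refine Finset.prod_congr rfl fun i _ => ?_
    rw [← hπ i]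
    rfl

/-- The complement of a thin cone contains a nonempty Zariski open set of hypersurfaces. -/
theorem exists_isZariskiOpen_of_thin [Infinite K] {B : Set (Exps r d → K)} (hB : Thin B)
    (hcone : ∀ x ∈ B, ∀ a : K, a ≠ 0 → a • x ∈ B) :
    ∃ U : Set (Hypersurface K r d), IsZariskiOpen U ∧ U.Nonempty ∧
      ∀ X ∈ U, coeffVec X.rep ∉ B := by
  obtain ⟨N, P, hP, hPN, hPB⟩ := hB.exists_isHomogeneous hcone
  refine ⟨{X | MvPolynomial.eval (coeffVec X.rep) P ≠ 0}, ⟨{MvPolynomial.rename Subtype.val P},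
    ?_, ?_⟩, ?_, fun X hX hB => hX (hPB _ hB)⟩
  · rintro _ rfl
    exact ⟨N, hPN.rename_isHomogeneous⟩
  · ext X
    simp only [Set.mem_compl_iff, Set.mem_ofPred_eq, not_not, Set.mem_singleton_iff, forall_eq,
      MvPolynomial.eval_rename]
    rfl
  · -- The factor `X e₀` makes sure that the form found is nonzero.
    let e₀ : Exps r d := ⟨Finsupp.single 0 d, by
      rw [Finset.mem_finsuppAntidiag]
      exact ⟨by simp, Finset.subset_univ _⟩⟩
    obtain ⟨x, hx⟩ : ∃ x, MvPolynomial.eval x (P * MvPolynomial.X e₀) ≠ 0 := by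
      by_contra! hc
      exact mul_ne_zero hP (MvPolynomial.X_ne_zero e₀) (MvPolynomial.funext (by simpa using hc))
    rw [map_mul, MvPolynomial.eval_X] at hx
    let F : Form K r d := ⟨∑ e : Exps r d, MvPolynomial.monomial e.1 (x e), by
      rw [MvPolynomial.mem_homogeneousSubmodule]
      refine MvPolynomial.IsHomogeneous.sum _ _ _ fun e _ => MvPolynomial.isHomogeneous_monomial _ ?_
      rw [Finsupp.degree_eq_sum]
      exact sum_exps e⟩
    have hF : coeffVec F = x := by
      ext e
      change MvPolynomial.coeff e.1 (∑ e : Exps r d, MvPolynomial.monomial e.1 (x e)) = x e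
      rw [MvPolynomial.coeff_sum, Finset.sum_eq_single e]
      · simp
      · intro e' _ he'
        rw [MvPolynomial.coeff_monomial, if_neg (fun h => he' (Subtype.ext h))]
      · simp
    have hF0 : F ≠ 0 := by
      rintro h0
      apply right_ne_zero_of_mul hx
      rw [← hF, h0]
      rfl
    refine ⟨Projectivization.mk K F hF0, ?_⟩
    obtain ⟨a, ha⟩ := Projectivization.exists_smul_eq_mk_rep K F hF0
    rw [Set.mem_ofPred_eq, ← ha, show a • F = (a : K) • F from rfl, coeffVec_smul, hF,
      eval_smul_of_isHomogeneous hPN]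
    exact mul_ne_zero (pow_ne_zero _ a.ne_zero) (left_ne_zero_of_mul hx)

end Main

end LineModuli

theorem mainTheorem5 {K : Type*} [Field K] [IsAlgClosed K] [CharZero K] (r d k : ℕ)
    (hk : (k : ℤ) = (d : ℤ) - (2 * (r : ℤ) - 2)) (hk4 : 4 ≤ k) :
    ∃ U : Set (LineModuli.Hypersurface K r d),
      LineModuli.IsZariskiOpen U ∧ U.Nonempty ∧
      ∀ X ∈ U, ∀ m : LineModuli.MultVector k d,
        (∀ ℓ : LineModuli.Line K r,
          (X, ℓ) ∈ LineModuli.incidence r m → (X, ℓ) ∈ LineModuli.openIncidence r m) ∧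
        ∀ (ℓ ℓ' : LineModuli.Line K r)
          (h : (X, ℓ) ∈ LineModuli.openIncidence r m)
          (h' : (X, ℓ') ∈ LineModuli.openIncidence r m),
          ℓ ≠ ℓ' →
            LineModuli.crossRatioMap r m ⟨(X, ℓ), h⟩ ≠
              LineModuli.crossRatioMap r m ⟨(X, ℓ'), h'⟩ := by
  have : Infinite K := IsAlgClosed.instInfinite
  obtain ⟨j, rfl⟩ : ∃ j, k = j + 4 := ⟨k - 4, by omega⟩
  have hthin : LineModuli.Thin {x : LineModuli.Exps r d → K |
      LineModuli.FewZeros (j + 3) x ∨ LineModuli.EquivalentZeros (j + 4) x} :=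
    (LineModuli.thin_fewZeros (by omega) (by omega)).union
      (LineModuli.thin_equivalentZeros (j := j + 1) (by omega) (by omega) (by omega))
  obtain ⟨U, hU, hne, hUB⟩ := LineModuli.exists_isZariskiOpen_of_thin hthin
    (fun x hx a ha => hx.imp (fun h => h.smul a) (fun h => h.smul ha))
  refine ⟨U, hU, hne, fun X hX m => ⟨fun ℓ hℓ => ?_, fun ℓ ℓ' h h' hne => ?_⟩⟩
  · have h1 : ¬ LineModuli.FewZeros (j + 3) (LineModuli.coeffVec X.rep) :=
      fun h => hUB X hX (Or.inl h)
    obtain ⟨u, v, hR, hu⟩ := LineModuli.exists_ne_zero_of_not_fewZeros (by omega) h1 ℓ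
    obtain ⟨a, ha⟩ := LineModuli.exists_zeros_of_mem_incidence hℓ hR hu
    by_cases hinj : Function.Injective a
    · exact LineModuli.mem_openIncidence_of_zeros hR hinj hu ha
    · exact absurd (LineModuli.fewZeros_of_not_injective hR.linearIndependent hinj m.sum_eq ha) h1
  · exact LineModuli.ne_of_mem_openIncidence (fun h => hUB X hX (Or.inl h))
      (fun h => hUB X hX (Or.inr h)) h h' hne
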